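/- Let $d\ge 1$, let $\Omega\subset\mathbb R^d$ be a bounded open set with boundary $\partial\Omega$, and let $\theta\in\mathbb R^d$ with $|\theta|=1$. Notation. $W_\theta(\Omega)$ is the space of all $u\in L^2(\Omega)$ which have a weak derivative $\partial_\theta u\in L^2(\Omega)$ in the direction $\theta$, i.e. $\int_\Omega u\,(\theta\cdot\nabla\varphi)\,dx=-\int_\Omega(\partial_\theta u)\,\varphi\,dx$ for all $\varphi\in C_c^\infty(\Omega)$; its norm is $\|u\|_\theta=\big(\|u\|_{L^2(\Omega)}^2+\|\partial_\theta u\|_{L^2(\Omega)}^2\big)^{1/2}$. For $x\in\Omega$, $\Phi_\theta(x)=x+\delta_\theta(x)\theta\in\partial\Omega$ with $\delta_\theta(x)=\sup\{s\ge0:\ x+t\theta\in\Omega\ \forall t\in[0,s)\}$, and $\mu_\theta$ is the finite Borel measure on $\partial\Omega$ given by $\mu_\theta(A)=\lambda^d(\{x\in\Omega:\Phi_\theta(x)\in A\})$. Let $H_\theta$ be the hyperplane orthogonal to $\theta$, $\mathcal P_\theta$ the orthogonal projection on $H_\theta$, and for $y\in H_\theta$ let $\omega_\theta(y)=\{s\in\mathbb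 R: s\theta+y\in\Omega\}$. A function $g:\partial\Omega\to\mathbb R$ is a directional trace of $u\in W_\theta(\Omega)$ in the direction $\theta$ if there are a representative of $u$ (again denoted $u$) and a set $A\subset\mathcal P_\theta(\Omega)$ such that $\mathcal P_\theta(\Omega)\setminus A$ is $\lambda^{d-1}$-negligible and, for all $y\in A$, the function $u_{\theta,y}:s\mapsto u(s\theta+y)$ belongs to $H^1(\omega_\theta(y))$ and, for each connected component $(\alpha,\beta)$ of $\omega_\theta(y)$, $u_{\theta,y}$ restricted to $(\alpha,\beta)$ has a representative $f$ continuous on $(\alpha,\beta]$ with $g(\beta\theta+y)=f(\beta)$. The directional trace $\gamma_\theta u$ is the set of all directional traces of $u$ in the direction $\theta$. Proposition. Let $u\in W_\theta(\Omega)$. Then $\gamma_\theta u\in L^2(\partial\Omega,\mu_\theta)$, that is, $\gamma_\theta u$ is exactly one class, for equality $\mu_\theta$-a.e., of functions on $\partial\Omega$ that are square integrable for $\mu_\theta$, and $$\int_{\partial\Omega}(\gamma_\theta u)^2\,d\mu_\theta\le 2\max\big(1,\operatorname{diam}(\Omega)^2\big)\,\|u\|_\theta^2 .$$ Moreover, if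 $\gamma_\theta u=0$ $\mu_\theta$-a.e. on $\partial\Omega$, then $$\|u\|_{L^2(\Omega)}\le\operatorname{diam}(\Omega)\,\|\partial_\theta u\|_{L^2(\Omega)} .$$ -/

import Mathlib

open MeasureTheory Set Filter Topology
open scoped ContDiff ENNReal

namespace DirTrace

/-- `f'` is a weak derivative of `f` in the direction `e` on the open set `U`: for every test
function `φ ∈ C_c^∞(U)`, `∫_U f ∂_e φ = - ∫_U f' φ`, where `∂_e φ (x) = Dφ(x) e`. -/
def HasWeakDirDeriv {V : Type*} [NormedAddCommGroup V] [NormedSpace ℝ V] [MeasureSpace V]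
    (U : Set V) (e : V) (f f' : V → ℝ) : Prop :=
  ∀ φ : V → ℝ, ContDiff ℝ ∞ φ → HasCompactSupport φ → tsupport φ ⊆ U →
    ∫ x in U, f x * fderiv ℝ φ x e = - ∫ x in U, f' x * φ x

/-- The function `f` (or rather its class) belongs to the Sobolev space `H¹(U)`, `U ⊆ ℝ` open. -/
def MemH1 (U : Set ℝ) (f : ℝ → ℝ) : Prop :=
  MemLp f 2 (volume.restrict U) ∧
    ∃ f' : ℝ → ℝ, MemLp f' 2 (volume.restrict U) ∧ HasWeakDirDeriv U (1 : ℝ) f f'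

section Space

variable {d : ℕ} (Ω : Set (EuclideanSpace ℝ (Fin d))) (θ : EuclideanSpace ℝ (Fin d))

/-- `L²(Ω)`, as a space of classes of functions. -/
abbrev L2 : Type := Lp ℝ 2 ((volume : Measure (EuclideanSpace ℝ (Fin d))).restrict Ω)

/-- `W_θ(Ω)`: the `u ∈ L²(Ω)` which have a weak derivative in the direction `θ` in `L²(Ω)`. -/
def W : Set (L2 Ω) := {u | ∃ v : L2 Ω, HasWeakDirDeriv Ω θ u v}

open Classical in
/-- The weak directional derivative `∂_θ u ∈ L²(Ω)` of `u ∈ W_θ(Ω)` (with the value `0` if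
`u ∉ W_θ(Ω)`). -/
noncomputable def dirDeriv (u : L2 Ω) : L2 Ω :=
  if h : ∃ v : L2 Ω, HasWeakDirDeriv Ω θ u v then h.choose else 0

/-- The norm of `W_θ(Ω)`: `‖u‖_θ = (‖u‖² + ‖∂_θ u‖²)^{1/2}`, with norms of `L²(Ω)`. -/
noncomputable def normW (u : L2 Ω) : ℝ :=
  Real.sqrt (‖u‖ ^ 2 + ‖dirDeriv Ω θ u‖ ^ 2)

/-- `δ_θ(x) = sup {s ≥ 0 : ∀ t ∈ [0,s[, x + t θ ∈ Ω}`. -/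
noncomputable def delta (x : EuclideanSpace ℝ (Fin d)) : ℝ :=
  sSup {s : ℝ | 0 ≤ s ∧ ∀ t ∈ Ico 0 s, x + t • θ ∈ Ω}

/-- `Φ_θ(x) = x + δ_θ(x) θ`: for `x ∈ Ω`, the first point of `∂Ω` seen from `x` in the
direction `θ`. -/
noncomputable def Phi (x : EuclideanSpace ℝ (Fin d)) : EuclideanSpace ℝ (Fin d) :=
  x + delta Ω θ x • θ

/-- The directional measure `μ_θ` on `∂Ω`: `μ_θ(A) = λ({x ∈ Ω : Φ_θ(x) ∈ A})` for every Borel set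
`A` of `∂Ω` (see `dirMeasure_apply`). -/
noncomputable def dirMeasure : Measure (frontier Ω) :=
  (((volume : Measure (EuclideanSpace ℝ (Fin d))).restrict Ω).map (Phi Ω θ)).comap Subtype.val

/-- The hyperplane `H_θ` orthogonal to `θ`; its measure `volume` is the `(d-1)`-dimensional
Lebesgue measure. -/
noncomputable abbrev Hyp : Submodule ℝ (EuclideanSpace ℝ (Fin d)) := (Submodule.span ℝ {θ})ᗮ

/-- `P_θ(Ω) ⊆ H_θ`, the image of `Ω` under the orthogonal projection on `H_θ`. -/
noncomputable def proj : Set (Hyp θ) := (fun x => (Hyp θ).orthogonalProjectionOnto x) '' Ω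

/-- `ω_θ(y) = {s ∈ ℝ : s θ + y ∈ Ω}`. -/
def omega (y : Hyp θ) : Set ℝ :=
  {s | s • θ + (y : EuclideanSpace ℝ (Fin d)) ∈ Ω}

/-- `]α,β[` is one of the disjoint bounded open intervals (the connected components) whose union
is `ω_θ(y)`. -/
def IsChord (y : Hyp θ) (α β : ℝ) : Prop :=
  α < β ∧ Ioo α β ⊆ omega Ω θ y ∧ α ∉ omega Ω θ y ∧ β ∉ omega Ω θ y

/-- `g : ∂Ω → ℝ` is a directional trace of `u` in the direction `θ`. Here `f` is the
representative of the restriction to `]α,β[` of `s ↦ u(s θ + y)` which is continuous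
on `]α,β]`. -/
def IsDirTrace (u : L2 Ω) (g : frontier Ω → ℝ) : Prop :=
  ∃ v : EuclideanSpace ℝ (Fin d) → ℝ, v =ᵐ[volume.restrict Ω] u ∧
    ∃ A : Set (Hyp θ), A ⊆ proj Ω θ ∧ volume (proj Ω θ \ A) = 0 ∧
      ∀ y ∈ A,
        MemH1 (omega Ω θ y) (fun s => v (s • θ + (y : EuclideanSpace ℝ (Fin d)))) ∧
        ∀ α β : ℝ, IsChord Ω θ y α β →
          ∃ f : ℝ → ℝ, ContinuousOn f (Ioc α β) ∧
            (∀ᵐ s ∂(volume.restrict (Ioo α β)),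
              f s = v (s • θ + (y : EuclideanSpace ℝ (Fin d)))) ∧
            ∃ hz : β • θ + (y : EuclideanSpace ℝ (Fin d)) ∈ frontier Ω, g ⟨_, hz⟩ = f β

/-- The directional trace `γ_θ u`: the set of all directional traces of `u` in the direction
`θ`. -/
def dirTrace (u : L2 Ω) : Set (frontier Ω → ℝ) := {g | IsDirTrace Ω θ u g}

end Space

section Facts

variable {d : ℕ} {Ω : Set (EuclideanSpace ℝ (Fin d))} {θ : EuclideanSpace ℝ (Fin d)}

theorem delta_bddAbove (hb : Bornology.IsBounded Ω) (hθ : ‖θ‖ = 1)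
    (x : EuclideanSpace ℝ (Fin d)) :
    BddAbove {s : ℝ | 0 ≤ s ∧ ∀ t ∈ Ico 0 s, x + t • θ ∈ Ω} := by
  refine ⟨Metric.diam Ω, ?_⟩
  rintro s ⟨hs0, hs⟩
  refine le_of_forall_lt fun c hc => ?_
  rcases lt_or_ge c 0 with h | h
  · exact h.trans_le Metric.diam_nonneg
  obtain ⟨t, hct, hts⟩ := exists_between hc
  have h0 : x + (0 : ℝ) • θ ∈ Ω := hs 0 ⟨le_rfl, h.trans_lt hc⟩
  have h1 := Metric.dist_le_diam_of_mem hb (hs t ⟨h.trans hct.le, hts⟩) h0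
  have h2 : dist (x + t • θ) (x + (0 : ℝ) • θ) = t := by
    rw [dist_add_left, zero_smul, dist_zero_right, norm_smul, hθ, mul_one,
      Real.norm_of_nonneg (h.trans hct.le)]
  linarith

theorem lt_delta_iff (ho : IsOpen Ω) (hb : Bornology.IsBounded Ω) (hθ : ‖θ‖ = 1)
    (x : EuclideanSpace ℝ (Fin d)) {c : ℝ} (hc : 0 ≤ c) :
    c < delta Ω θ x ↔ ∀ t ∈ Icc 0 c, x + t • θ ∈ Ω := by
  constructor
  · intro h t ht
    obtain ⟨s, ⟨_, hs⟩, hcs⟩ := exists_lt_of_lt_csSup (s := {s : ℝ | 0 ≤ s ∧ ∀ t ∈ Ico 0 s, x + t • θ ∈ Ω})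
      ⟨0, le_rfl, by simp⟩ h
    exact hs t ⟨ht.1, ht.2.trans_lt hcs⟩
  · intro h
    have hcont : Continuous fun t : ℝ => x + t • θ := by fun_prop
    obtain ⟨ε, hε, hball⟩ := Metric.isOpen_iff.1 (ho.preimage hcont) c (h c ⟨hc, le_rfl⟩)
    refine lt_of_lt_of_le (lt_add_of_pos_right c hε)
      (le_csSup (delta_bddAbove hb hθ x) ⟨by positivity, fun t ht => ?_⟩)
    rcases le_or_gt t c with h1 | h1
    · exact h t ⟨ht.1, h1⟩
    · refine hball ?_
      rw [Metric.mem_ball, Real.dist_eq, abs_of_pos (sub_pos.2 h1)]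
      linarith [ht.2]

theorem measurable_Phi (ho : IsOpen Ω) (hb : Bornology.IsBounded Ω) (hθ : ‖θ‖ = 1) :
    Measurable (Phi Ω θ) := by
  have hδ : Measurable (delta Ω θ) := by
    refine measurable_of_Ioi fun c => ?_
    rcases lt_or_ge c 0 with h | h
    · have : delta Ω θ ⁻¹' Ioi c = univ := by
        refine eq_univ_of_forall fun x => h.trans_le ?_
        exact le_csSup (delta_bddAbove hb hθ x) ⟨le_rfl, by simp⟩
      rw [this]; exact MeasurableSet.univ
    · have : delta Ω θ ⁻¹' Ioi c = {x | ∀ t ∈ Icc 0 c, x + t • θ ∈ Ω} := by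
        ext x; exact lt_delta_iff ho hb hθ x h
      rw [this]
      refine IsOpen.measurableSet (isOpen_iff_mem_nhds.2 fun x hx => ?_)
      refine isCompact_Icc.eventually_forall_of_forall_eventually fun t ht => ?_
      have hcont : Continuous fun p : EuclideanSpace ℝ (Fin d) × ℝ => p.1 + p.2 • θ := by
        fun_prop
      exact hcont.continuousAt.eventually (ho.mem_nhds (hx t ht))
  exact measurable_id.add (hδ.smul_const θ)

/-- `Φ_θ` maps `Ω` into `∂Ω`. -/
theorem Phi_mem_frontier (ho : IsOpen Ω) (hb : Bornology.IsBounded Ω) (hθ : ‖θ‖ = 1)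
    {x : EuclideanSpace ℝ (Fin d)} (hx : x ∈ Ω) : Phi Ω θ x ∈ frontier Ω := by
  have hpos : 0 < delta Ω θ x := by
    rw [lt_delta_iff ho hb hθ x le_rfl]
    intro t ht
    have : t = 0 := le_antisymm ht.2 ht.1
    simpa [this] using hx
  have hmem : ∀ t ∈ Ico 0 (delta Ω θ x), x + t • θ ∈ Ω := fun t ht =>
    (lt_delta_iff ho hb hθ x ht.1).1 ht.2 t ⟨ht.1, le_rfl⟩
  rw [ho.frontier_eq]
  refine ⟨?_, fun hin => ?_⟩
  · have hcont : Continuous fun t : ℝ => x + t • θ := by fun_prop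
    have h1 : delta Ω θ x ∈ closure (Ico 0 (delta Ω θ x)) := by
      rw [closure_Ico hpos.ne]; exact ⟨hpos.le, le_rfl⟩
    exact map_mem_closure (f := fun t : ℝ => x + t • θ) hcont h1 hmem
  · refine lt_irrefl (delta Ω θ x) ((lt_delta_iff ho hb hθ x hpos.le).2 fun t ht => ?_)
    rcases ht.2.lt_or_eq with h | h
    · exact hmem t ⟨ht.1, h⟩
    · rw [h]; exact hin

theorem dirMeasure_apply (ho : IsOpen Ω) (hb : Bornology.IsBounded Ω) (hθ : ‖θ‖ = 1)
    {A : Set (frontier Ω)} (hA : MeasurableSet A) :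
    dirMeasure Ω θ A = volume (Ω ∩ {x | ∃ z ∈ A, (z : EuclideanSpace ℝ (Fin d)) = Phi Ω θ x}) := by
  have hF : MeasurableSet (frontier Ω) := isClosed_frontier.measurableSet
  rw [dirMeasure, (MeasurableEmbedding.subtype_coe hF).comap_apply,
    Measure.map_apply (measurable_Phi ho hb hθ) (hF.subtype_image hA),
    Measure.restrict_apply' ho.measurableSet, inter_comm]
  rfl

end Facts

end DirTrace

/-! Replace `u` and its weak derivative by Borel functions `U`, `V` vanishing off `Ω`. The average
`ψ(x) = ∫₀ᵗ φ(x - sθ) ds` is a test function with `∂_θ ψ(x) = φ(x) - φ(x - tθ)`. Testing with it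
moves the difference onto `U`: `U(x + tθ) - U(x) = ∫₀ᵗ V(x + rθ) dr` for a.e. `x` whose segment of
length `t` stays in `Ω` (`ae_sub_eq_integral_of_weakDeriv`).

By Fubini, `U` thus agrees a.e. on almost every chord with a function continuous up to the exit
point. Its value there is the limit of averages `endValue`, so `U(x) = endValue (Φ x) - ∫₀^δ V(x +
rθ) dr` a.e. on `Ω` (`ae_eq_endValue_sub`). Both inequalities follow by Cauchy–Schwarz, `δ ≤ diam Ω`
and translation invariance, because `μ_θ` is the image of Lebesgue measure on `Ω` under `Φ`.

It remains to see that the traces are exactly the functions `μ_θ`-a.e. equal to `endValue`. In the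
coordinates `H_θ × ℝ` the formula describes `U` on almost every line as a constant minus a tail
integral of `V`. This gives the `H¹` property and the continuous representative (`isDirTrace`);
uniqueness of continuous representatives gives the converse (`ae_eq_of_isDirTrace`). -/

namespace DirTrace

/-! ### Averages of test functions along segments -/

section SegmentIntegral

variable {E : Type*} [NormedAddCommGroup E] [NormedSpace ℝ E]

/-- The average is the convolution of `φ` with the image of Lebesgue measure on `(0, t]` under `s ↦
sθ`, hence as smooth as `φ`. -/
theorem contDiff_segmentIntegral {φ : E → ℝ} (hφ : ContDiff ℝ ∞ φ)
    (hc : HasCompactSupport φ) (θ : E) {t : ℝ} (ht : 0 ≤ t) :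
    ContDiff ℝ ∞ fun x => ∫ s in (0 : ℝ)..t, φ (x - s • θ) := by
  borelize E
  have hm : Measurable fun s : ℝ => s • θ := by
    have : Continuous fun s : ℝ => s • θ := by fun_prop
    exact this.measurable
  set μ : Measure E := ((volume : Measure ℝ).restrict (Ioc 0 t)).map fun s => s • θ with hμ
  have hfin : IsFiniteMeasure μ := Measure.isFiniteMeasure_map _ _
  have h := HasCompactSupport.contDiff_convolution_right (n := ⊤) (μ := μ)
    (ContinuousLinearMap.mul ℝ ℝ) (f := fun _ => (1 : ℝ)) hc
    (integrable_const (1 : ℝ)).locallyIntegrable hφ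
  convert h using 1
  ext x
  rw [convolution_def, intervalIntegral.integral_of_le ht, hμ]
  have hcl : Topology.IsClosedEmbedding (fun s : ℝ => s • θ) ∨ θ = 0 := by
    rcases eq_or_ne θ 0 with h0 | h0
    · exact Or.inr h0
    · exact Or.inl (isClosedEmbedding_smul_left h0)
  rcases hcl with hcl | h0
  · rw [hcl.measurableEmbedding.integral_map]
    simp
  · have : (fun s : ℝ => s • θ) = fun _ => (0 : E) := by ext s; simp [h0]
    rw [this, Measure.map_const]
    simp [h0, Measure.real]

/-- Moving `x` by `hθ` only shifts the interval of integration to `[-h, t - h]`; the fundamental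
theorem of calculus applies at both ends. -/
theorem fderiv_segmentIntegral {φ : E → ℝ} (hφ : ContDiff ℝ ∞ φ)
    (hc : HasCompactSupport φ) (θ : E) {t : ℝ} (ht : 0 ≤ t) (x : E) :
    fderiv ℝ (fun x => ∫ s in (0 : ℝ)..t, φ (x - s • θ)) x θ = φ x - φ (x - t • θ) := by
  have hd : DifferentiableAt ℝ (fun x => ∫ s in (0 : ℝ)..t, φ (x - s • θ)) x :=
    (contDiff_segmentIntegral hφ hc θ ht).differentiable (by simp) x
  have hline : HasDerivAt (fun h : ℝ => x + h • θ) θ 0 := by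
    simpa using ((hasDerivAt_id (0 : ℝ)).smul_const θ).const_add x
  have h1 := (by simpa using hd.hasFDerivAt : HasFDerivAt
    (fun x => ∫ s in (0 : ℝ)..t, φ (x - s • θ)) _ (x + (0 : ℝ) • θ)).comp_hasDerivAt (0 : ℝ) hline
  have hF : Continuous fun r : ℝ => φ (x - r • θ) :=
    hφ.continuous.comp (by fun_prop)
  have h2 : ∀ h : ℝ, (∫ s in (0 : ℝ)..t, φ (x + h • θ - s • θ))
      = (∫ s in (0 : ℝ)..(t - h), φ (x - s • θ)) - ∫ s in (0 : ℝ)..(-h), φ (x - s • θ) := by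
    intro h
    rw [intervalIntegral.integral_interval_sub_left (hF.intervalIntegrable _ _)
      (hF.intervalIntegrable _ _)]
    have := intervalIntegral.integral_comp_sub_right (fun r : ℝ => φ (x - r • θ)) (a := 0)
      (b := t) h
    rw [zero_sub] at this
    rw [← this]
    refine intervalIntegral.integral_congr fun s _ => congrArg φ ?_
    rw [sub_smul]; abel
  have hp : ∀ b : ℝ, HasDerivAt (fun b : ℝ => ∫ s in (0 : ℝ)..b, φ (x - s • θ))
      (φ (x - b • θ)) b := fun b =>
    intervalIntegral.integral_hasDerivAt_right (hF.intervalIntegrable _ _)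
      (hF.stronglyMeasurableAtFilter _ _) hF.continuousAt
  have ha : HasDerivAt (fun h : ℝ => t - h) (-1) 0 := by
    simpa using (hasDerivAt_id (0 : ℝ)).const_sub t
  have hb : HasDerivAt (fun h : ℝ => -h) (-1) 0 := hasDerivAt_neg 0
  have h3 := ((hp (t - 0)).comp (0 : ℝ) ha).sub ((hp (-0)).comp (0 : ℝ) hb)
  have h4 : HasDerivAt (fun h : ℝ => ∫ s in (0 : ℝ)..t, φ (x + h • θ - s • θ)) _ 0 :=
    h3.congr_of_eventuallyEq (Eventually.of_forall h2)
  have h5 := h1.unique h4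
  rw [h5, sub_zero, neg_zero, zero_smul, sub_zero]; ring

/-- The support lies in the compact set `tsupport φ + [0, t]θ`. So the average is admissible in `Ω`
once every segment of length `t` issued from `tsupport φ` stays in `Ω`. -/
theorem tsupport_segmentIntegral {φ : E → ℝ} (hc : HasCompactSupport φ) (θ : E) {t : ℝ}
    (ht : 0 ≤ t) :
    HasCompactSupport (fun x => ∫ s in (0 : ℝ)..t, φ (x - s • θ)) ∧
      tsupport (fun x => ∫ s in (0 : ℝ)..t, φ (x - s • θ)) ⊆
        {x | ∃ s ∈ Icc 0 t, ∃ y ∈ tsupport φ, x = y + s • θ} := by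
  set K : Set E := (fun p : E × ℝ => p.1 + p.2 • θ) '' (tsupport φ ×ˢ Icc 0 t)
  have hK : IsCompact K := (hc.isCompact.prod isCompact_Icc).image (by fun_prop)
  have hsub : Function.support (fun x => ∫ s in (0 : ℝ)..t, φ (x - s • θ)) ⊆ K := by
    intro x hx
    by_contra hxK
    refine hx ?_
    simp only
    rw [intervalIntegral.integral_of_le ht]
    refine setIntegral_eq_zero_of_forall_eq_zero fun s hs => ?_
    by_contra hne
    exact hxK ⟨(x - s • θ, s), ⟨subset_tsupport _ hne, hs.1.le, hs.2⟩, by simp⟩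
  refine ⟨HasCompactSupport.intro hK fun x hx => ?_, fun x hx => ?_⟩
  · by_contra h; exact hx (hsub h)
  · obtain ⟨⟨y, s⟩, ⟨hy, hs⟩, rfl⟩ := closure_minimal hsub hK.isClosed hx
    exact ⟨s, hs, y, hy, rfl⟩

end SegmentIntegral

/-! ### Integrating a weak derivative along segments -/

section Shift

variable {E : Type*} [NormedAddCommGroup E] [NormedSpace ℝ E] [FiniteDimensional ℝ E]
  [MeasurableSpace E] [BorelSpace E] {μ : Measure E} [μ.IsAddHaarMeasure]

theorem measurable_add_smul (θ : E) : Measurable fun p : E × ℝ => p.1 + p.2 • θ :=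
  measurable_fst.add (measurable_snd.smul_const θ)

theorem integrable_comp_add_smul {V : E → ℝ} (hVm : Measurable V) (hV : Integrable V μ) (θ : E)
    (ν : Measure ℝ) [IsFiniteMeasure ν] :
    Integrable (fun p : E × ℝ => V (p.1 + p.2 • θ)) (μ.prod ν) := by
  refine (integrable_prod_iff' (hVm.comp (measurable_add_smul θ)).aestronglyMeasurable).2 ?_
  refine ⟨Eventually.of_forall fun s => hV.comp_add_right (s • θ), ?_⟩
  simp_rw [Function.comp_apply, integral_add_right_eq_self (fun x => ‖V x‖)]
  exact integrable_const _

theorem ae_intervalIntegrable_comp_add_smul {V : E → ℝ} (hVm : Measurable V)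
    (hV : Integrable V μ) (θ : E) :
    ∀ᵐ x ∂μ, ∀ a b : ℝ, IntervalIntegrable (fun r : ℝ => V (x + r • θ)) volume a b := by
  have h : ∀ n : ℕ, ∀ᵐ x ∂μ,
      IntegrableOn (fun r : ℝ => V (x + r • θ)) (Ioc (-(n : ℝ)) n) volume := fun n =>
    (integrable_comp_add_smul hVm hV θ (volume.restrict (Ioc (-(n : ℝ)) n))).prod_right_ae
  filter_upwards [ae_all_iff.2 h] with x hx a b
  obtain ⟨n, hn⟩ := exists_nat_ge (max |a| |b|)
  rw [intervalIntegrable_iff]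
  refine (hx n).mono_set fun s hs => ?_
  have ha := abs_le.1 ((le_max_left _ _).trans hn)
  have hb := abs_le.1 ((le_max_right _ _).trans hn)
  exact ⟨(le_min ha.1 hb.1).trans_lt hs.1, hs.2.trans (max_le ha.2 hb.2)⟩

/-- Integration of a weak directional derivative along segments of fixed length. -/
theorem ae_sub_eq_integral_of_weakDeriv {Ω : Set E} (hΩ : IsOpen Ω) {θ : E} {U V : E → ℝ}
    (hU : Integrable U μ) (hVm : Measurable V) (hV : Integrable V μ)
    (hw : ∀ φ : E → ℝ, ContDiff ℝ ∞ φ → HasCompactSupport φ → tsupport φ ⊆ Ω →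
      ∫ x, U x * fderiv ℝ φ x θ ∂μ = - ∫ x, V x * φ x ∂μ) {t : ℝ} (ht : 0 ≤ t) :
    ∀ᵐ x ∂μ, (∀ s ∈ Icc 0 t, x + s • θ ∈ Ω) →
      U (x + t • θ) - U x = ∫ r in (0 : ℝ)..t, V (x + r • θ) := by
  have hopen : IsOpen {x : E | ∀ s ∈ Icc 0 t, x + s • θ ∈ Ω} := by
    refine isOpen_iff_mem_nhds.2 fun x hx => ?_
    refine isCompact_Icc.eventually_forall_of_forall_eventually fun s hs => ?_
    have hcont : Continuous fun p : E × ℝ => p.1 + p.2 • θ := by fun_prop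
    exact hcont.continuousAt.eventually (hΩ.mem_nhds (hx s hs))
  have hprod := integrable_comp_add_smul hVm hV θ (volume.restrict (Ioc 0 t))
  have hint : Integrable (fun x => ∫ r in (0 : ℝ)..t, V (x + r • θ)) μ := by
    simp_rw [intervalIntegral.integral_of_le ht]
    exact hprod.integral_prod_left
  have hUt : Integrable (fun x => U (x + t • θ)) μ := hU.comp_add_right (t • θ)
  -- Fundamental lemma of the calculus of variations, on the open set of `x` whose whole segment
  -- lies in `Ω`.
  have key := hopen.ae_eq_zero_of_integral_contDiff_smul_eq_zero (μ := μ)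
    (f := fun x => U (x + t • θ) - U x - ∫ r in (0 : ℝ)..t, V (x + r • θ))
    (LocallyIntegrable.locallyIntegrableOn (Integrable.locallyIntegrable
      ((hUt.sub hU).sub hint)) _) ?_
  · filter_upwards [key] with x hx h
    exact sub_eq_zero.1 (hx h)
  intro φ hφ hc hsupp
  obtain ⟨C, hC⟩ := hc.exists_bound_of_continuous hφ.continuous
  have hmul : ∀ {f : E → ℝ}, Integrable f μ → Integrable (fun x => φ x * f x) μ := fun hf =>
    hf.bdd_mul hφ.continuous.aestronglyMeasurable (Eventually.of_forall hC)
  obtain ⟨hψc, hψs⟩ := tsupport_segmentIntegral hc θ ht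
  have h1 := hw _ (contDiff_segmentIntegral hφ hc θ ht) hψc (hψs.trans ?_)
  swap
  · rintro x ⟨s, hs, y, hy, rfl⟩
    exact hsupp hy s hs
  simp_rw [fderiv_segmentIntegral hφ hc θ ht] at h1
  have h2 : ∫ x, U x * (φ x - φ (x - t • θ)) ∂μ
      = ∫ x, φ x * U x ∂μ - ∫ x, φ x * U (x + t • θ) ∂μ := by
    rw [← integral_sub_right_eq_self (fun x => φ x * U (x + t • θ)) (t • θ), ← integral_sub]
    · refine integral_congr_ae (Eventually.of_forall fun x => ?_)
      simp only [sub_add_cancel]; ring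
    · exact hmul hU
    · exact (hmul hUt).comp_sub_right (t • θ)
  -- Fubini, then a translation by `sθ` for each fixed `s`.
  have h3 : ∫ x, V x * (∫ s in (0 : ℝ)..t, φ (x - s • θ)) ∂μ
      = ∫ x, φ x * (∫ r in (0 : ℝ)..t, V (x + r • θ)) ∂μ := by
    simp_rw [intervalIntegral.integral_of_le ht, ← integral_const_mul]
    have hp2 : Integrable (fun p : E × ℝ => φ p.1 * V (p.1 + p.2 • θ))
        (μ.prod (volume.restrict (Ioc 0 t))) :=
      hprod.bdd_mul (hφ.continuous.comp continuous_fst).aestronglyMeasurable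
        (Eventually.of_forall fun p => hC p.1)
    have hp1 : Integrable (fun p : E × ℝ => V p.1 * φ (p.1 - p.2 • θ))
        (μ.prod (volume.restrict (Ioc 0 t))) := by
      have hV1 : Integrable (fun p : E × ℝ => V p.1) (μ.prod (volume.restrict (Ioc 0 t))) :=
        hV.comp_fst _
      refine (hV1.bdd_mul (f := fun p : E × ℝ => φ (p.1 - p.2 • θ)) (c := C)
        (Continuous.aestronglyMeasurable ?_) (Eventually.of_forall fun p => hC _)).congr
        (Eventually.of_forall fun p => mul_comm _ _)
      exact hφ.continuous.comp (by fun_prop)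
    rw [integral_integral_swap (f := fun x s => V x * φ (x - s • θ)) hp1,
      integral_integral_swap (f := fun x s => φ x * V (x + s • θ)) hp2]
    refine integral_congr_ae (Eventually.of_forall fun s => ?_)
    simp only
    rw [← integral_sub_right_eq_self (fun x => φ x * V (x + s • θ)) (s • θ)]
    refine integral_congr_ae (Eventually.of_forall fun x => ?_)
    simp only [sub_add_cancel]; ring
  rw [h2, h3] at h1
  simp_rw [smul_eq_mul, mul_sub]
  have hd : Integrable (fun x => φ x * U (x + t • θ) - φ x * U x) μ := (hmul hUt).sub (hmul hU)
  rw [integral_sub hd (hmul hint), integral_sub (hmul hUt) (hmul hU)]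
  linarith

end Shift

/-! ### Values at the ends of chords -/

/-- The averages are eventually difference quotients at `0` of a primitive of `F`; the a.e. class of
`w` alone determines them. -/
theorem tendsto_average_zero {w F : ℝ → ℝ} (hF : Continuous F) {δ : ℝ} (hδ : 0 < δ)
    (h : ∀ᵐ s, 0 < s → s < δ → w s = F s) :
    Tendsto (fun n : ℕ => ((n : ℝ) + 1) * ∫ s in (0 : ℝ)..1 / ((n : ℝ) + 1), w s) atTop
      (𝓝 (F 0)) := by
  have hd : HasDerivAt (fun b : ℝ => ∫ s in (0 : ℝ)..b, F s) (F 0) 0 :=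
    intervalIntegral.integral_hasDerivAt_right (hF.intervalIntegrable _ _)
      (hF.stronglyMeasurableAtFilter _ _) hF.continuousAt
  have hlim : Tendsto (fun n : ℕ => 1 / ((n : ℝ) + 1)) atTop (𝓝 0) :=
    tendsto_one_div_add_atTop_nhds_zero_nat
  have hlim' : Tendsto (fun n : ℕ => 1 / ((n : ℝ) + 1)) atTop (𝓝[≠] 0) :=
    tendsto_nhdsWithin_iff.2 ⟨hlim, Eventually.of_forall fun n => by
      simp only [mem_compl_iff, mem_singleton_iff]; positivity⟩
  refine (hd.tendsto_slope.comp hlim').congr' ?_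
  filter_upwards [hlim.eventually (gt_mem_nhds hδ)] with n hn
  have hpos : (0 : ℝ) ≤ 1 / ((n : ℝ) + 1) := by positivity
  simp only [Function.comp, slope_def_field, intervalIntegral.integral_same, sub_zero]
  rw [div_div_eq_mul_div, div_one, mul_comm]
  congr 1
  refine intervalIntegral.integral_congr_ae ?_
  filter_upwards [h] with s hs hmem
  rw [uIoc_of_le hpos] at hmem
  exact (hs hmem.1 (hmem.2.trans_lt hn)).symm

section Trace

variable {d : ℕ}

/-- `U` and `V` are Borel representatives, extended by zero outside `Ω`, of a function in
`W_θ(Ω)` and of its weak derivative. -/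
structure IsBorelRep (Ω : Set (EuclideanSpace ℝ (Fin d))) (θ : EuclideanSpace ℝ (Fin d)) (U V : EuclideanSpace ℝ (Fin d) → ℝ) : Prop where
  isOpen : IsOpen Ω
  isBounded : Bornology.IsBounded Ω
  norm_eq : ‖θ‖ = 1
  meas : Measurable U
  meas' : Measurable V
  memLp : MemLp U 2 volume
  memLp' : MemLp V 2 volume
  eq_zero : ∀ x ∉ Ω, U x = 0
  eq_zero' : ∀ x ∉ Ω, V x = 0
  weak : ∀ φ : EuclideanSpace ℝ (Fin d) → ℝ, ContDiff ℝ ∞ φ → HasCompactSupport φ → tsupport φ ⊆ Ω →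
    ∫ x, U x * fderiv ℝ φ x θ = - ∫ x, V x * φ x

/-- The limit of the averages of `U` over the segments `[z - θ / (n + 1), z]`. -/
noncomputable def endValue (θ : EuclideanSpace ℝ (Fin d)) (U : EuclideanSpace ℝ (Fin d) → ℝ) (z : EuclideanSpace ℝ (Fin d)) : ℝ :=
  limsup (fun n : ℕ => ((n : ℝ) + 1) * ∫ s in (0 : ℝ)..1 / ((n : ℝ) + 1), U (z - s • θ)) atTop

/-- The `limsup` is what gives one Borel function defined at every point, with no choice of a
representative on each line. -/
theorem measurable_endValue (θ : EuclideanSpace ℝ (Fin d)) {U : EuclideanSpace ℝ (Fin d) → ℝ} (hU : Measurable U) :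
    Measurable (endValue θ U) := by
  refine Measurable.limsup fun n => Measurable.const_mul ?_ _
  have hpos : (0 : ℝ) ≤ 1 / ((n : ℝ) + 1) := by positivity
  simp_rw [intervalIntegral.integral_of_le hpos]
  have h : Measurable fun p : EuclideanSpace ℝ (Fin d) × ℝ => U (p.1 - p.2 • θ) :=
    hU.comp (measurable_fst.sub (measurable_snd.smul_const θ))
  exact (h.stronglyMeasurable.integral_prod_right
    (ν := volume.restrict (Ioc 0 (1 / ((n : ℝ) + 1))))).measurable

theorem measurable_delta {Ω : Set (EuclideanSpace ℝ (Fin d))} {θ : EuclideanSpace ℝ (Fin d)} (ho : IsOpen Ω) (hb : Bornology.IsBounded Ω)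
    (hθ : ‖θ‖ = 1) : Measurable (delta Ω θ) := by
  have h : delta Ω θ = fun x => inner ℝ (Phi Ω θ x - x) θ := by
    ext x
    rw [Phi, add_sub_cancel_left, real_inner_smul_left, real_inner_self_eq_norm_sq, hθ]
    ring
  rw [h]
  exact ((measurable_Phi ho hb hθ).sub measurable_id).inner_const

theorem delta_nonneg {Ω : Set (EuclideanSpace ℝ (Fin d))} {θ : EuclideanSpace ℝ (Fin d)} (hb : Bornology.IsBounded Ω)
    (hθ : ‖θ‖ = 1) (x : EuclideanSpace ℝ (Fin d)) : 0 ≤ delta Ω θ x :=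
  le_csSup (delta_bddAbove hb hθ x) ⟨le_rfl, by simp⟩

theorem delta_pos {Ω : Set (EuclideanSpace ℝ (Fin d))} {θ : EuclideanSpace ℝ (Fin d)} (ho : IsOpen Ω) (hb : Bornology.IsBounded Ω)
    (hθ : ‖θ‖ = 1) {x : EuclideanSpace ℝ (Fin d)} (hx : x ∈ Ω) : 0 < delta Ω θ x := by
  rw [lt_delta_iff ho hb hθ x le_rfl]
  intro t ht
  have : t = 0 := le_antisymm ht.2 ht.1
  simpa [this] using hx

namespace IsBorelRep

variable {Ω : Set (EuclideanSpace ℝ (Fin d))} {θ : EuclideanSpace ℝ (Fin d)} {U V : EuclideanSpace ℝ (Fin d) → ℝ}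

theorem integrable_of_memLp {f : EuclideanSpace ℝ (Fin d) → ℝ} (hb : Bornology.IsBounded Ω)
    (hf : MemLp f 2 volume) (h0 : ∀ x ∉ Ω, f x = 0) : Integrable f volume := by
  rw [← integrableOn_iff_integrable_of_support_subset (s := Ω)
    (fun x hx => by by_contra h; exact hx (h0 x h))]
  have : IsFiniteMeasure (volume.restrict Ω) :=
    isFiniteMeasure_restrict.2 hb.measure_lt_top.ne
  exact (hf.restrict Ω).integrable (by norm_num)

theorem integrable (h : IsBorelRep Ω θ U V) : Integrable U volume :=
  integrable_of_memLp h.isBounded h.memLp h.eq_zero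

theorem integrable' (h : IsBorelRep Ω θ U V) : Integrable V volume :=
  integrable_of_memLp h.isBounded h.memLp' h.eq_zero'

/-- For each fixed `t` the identity holds for a.e. `x`; Fubini exchanges the two quantifiers. -/
theorem ae_ae_eq_add_integral (h : IsBorelRep Ω θ U V) :
    ∀ᵐ x, ∀ᵐ t : ℝ, 0 ≤ t → t < delta Ω θ x →
      U (x + t • θ) = U x + ∫ r in (0 : ℝ)..t, V (x + r • θ) := by
  -- The indicator absorbs the variable upper limit, so that joint measurability in `(x, t)` comes
  -- from a parametric integral over all of `ℝ`.
  set I : EuclideanSpace ℝ (Fin d) × ℝ → ℝ := fun q => ∫ r, {p : (EuclideanSpace ℝ (Fin d) × ℝ) × ℝ | 0 < p.2 ∧ p.2 ≤ p.1.2}.indicator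
    (fun p => V (p.1.1 + p.2 • θ)) (q, r) with hI
  have hIm : Measurable I := by
    refine (StronglyMeasurable.integral_prod_right' (ν := (volume : Measure ℝ))
      (Measurable.stronglyMeasurable (Measurable.indicator ?_ ?_))).measurable
    · exact h.meas'.comp ((measurable_fst.comp measurable_fst).add
        (measurable_snd.smul_const θ))
    · exact (measurableSet_lt measurable_const measurable_snd).inter
        (measurableSet_le measurable_snd (measurable_snd.comp measurable_fst))
  have hIeq : ∀ x : EuclideanSpace ℝ (Fin d), ∀ t : ℝ, 0 ≤ t → I (x, t) = ∫ r in (0 : ℝ)..t, V (x + r • θ) := by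
    intro x t ht
    rw [intervalIntegral.integral_of_le ht, ← integral_indicator measurableSet_Ioc]
    rfl
  have hset : MeasurableSet {p : EuclideanSpace ℝ (Fin d) × ℝ | 0 ≤ p.2 → p.2 < delta Ω θ p.1 →
      U (p.1 + p.2 • θ) = U p.1 + I p} := by
    have hδ := measurable_delta h.isOpen h.isBounded h.norm_eq
    refine (measurableSet_le measurable_const measurable_snd).imp
      ((measurableSet_lt measurable_snd (hδ.comp measurable_fst)).imp
        (measurableSet_eq_fun ?_ ?_))
    · exact h.meas.comp (measurable_add_smul θ)
    · exact (h.meas.comp measurable_fst).add hIm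
  have key : ∀ᵐ x, ∀ᵐ t : ℝ, 0 ≤ t → t < delta Ω θ x → U (x + t • θ) = U x + I (x, t) := by
    rw [Measure.ae_ae_comm (p := fun (x : EuclideanSpace ℝ (Fin d)) (t : ℝ) => 0 ≤ t → t < delta Ω θ x →
      U (x + t • θ) = U x + I (x, t)) hset]
    refine Eventually.of_forall fun t => ?_
    rcases lt_or_ge t 0 with ht | ht
    · exact Eventually.of_forall fun x h0 => absurd h0 (not_le.2 ht)
    filter_upwards [ae_sub_eq_integral_of_weakDeriv h.isOpen h.integrable h.meas' h.integrable'
      h.weak ht] with x hx _ hlt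
    rw [hIeq x t ht, ← hx ((lt_delta_iff h.isOpen h.isBounded h.norm_eq x ht).1 hlt)]
    ring
  filter_upwards [key] with x hx
  filter_upwards [hx] with t ht h0 hlt
  rw [ht h0 hlt, hIeq x t h0]

/-- The value at `x` is recovered from the value at the end of the chord through `x`. -/
theorem ae_eq_endValue_sub (h : IsBorelRep Ω θ U V) :
    ∀ᵐ x, x ∈ Ω →
      U x = endValue θ U (Phi Ω θ x) - ∫ r in (0 : ℝ)..delta Ω θ x, V (x + r • θ) := by
  filter_upwards [h.ae_ae_eq_add_integral,
    ae_intervalIntegrable_comp_add_smul h.meas' h.integrable' θ] with x hx hint hxΩ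
  have hδ := delta_pos h.isOpen h.isBounded h.norm_eq hxΩ
  set δ := delta Ω θ x with hδdef
  have hcont : Continuous fun t : ℝ => U x + ∫ r in (0 : ℝ)..t, V (x + r • θ) :=
    continuous_const.add (intervalIntegral.continuous_primitive hint 0)
  have hF : Continuous fun s : ℝ => U x + ∫ r in (0 : ℝ)..(δ - s), V (x + r • θ) :=
    hcont.comp (continuous_const.sub continuous_id)
  have hae : ∀ᵐ s : ℝ, 0 < s → s < δ → U (Phi Ω θ x - s • θ)
      = U x + ∫ r in (0 : ℝ)..(δ - s), V (x + r • θ) := by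
    -- The reflection `t = δ - s` measures position backwards from the exit point and preserves null
    -- sets.
    have := (Measure.measurePreserving_sub_left (volume : Measure ℝ) δ).quasiMeasurePreserving.ae hx
    filter_upwards [this] with s hs h0 h1
    rw [← hs (by linarith) (by linarith), Phi, ← hδdef, sub_smul]
    congr 1; abel
  have hlim := tendsto_average_zero hF hδ hae
  rw [endValue, hlim.limsup_eq]
  rw [sub_zero]; ring

end IsBorelRep

end Trace

/-! ### The `L²` estimates -/

/-- Cauchy–Schwarz, read off from the nonnegativity of the integral of `(f - m)²`, with `m` the mean
of `f`. -/
theorem sq_intervalIntegral_le {f : ℝ → ℝ} {a b : ℝ} (hab : a ≤ b)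
    (hf : IntervalIntegrable f volume a b)
    (hf2 : IntervalIntegrable (fun r => f r ^ 2) volume a b) :
    (∫ r in a..b, f r) ^ 2 ≤ (b - a) * ∫ r in a..b, f r ^ 2 := by
  rcases hab.eq_or_lt with rfl | hlt
  · simp
  have hpos : 0 < b - a := sub_pos.2 hlt
  set m := (∫ r in a..b, f r) / (b - a) with hm
  have h0 : 0 ≤ ∫ r in a..b, (f r - m) ^ 2 :=
    intervalIntegral.integral_nonneg hab fun r _ => sq_nonneg _
  have h1 : ∫ r in a..b, (f r - m) ^ 2
      = (∫ r in a..b, f r ^ 2) - 2 * m * (∫ r in a..b, f r) + (b - a) * m ^ 2 := by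
    have : (fun r => (f r - m) ^ 2) = fun r => f r ^ 2 - 2 * m * f r + m ^ 2 := by
      ext r; ring
    rw [this, intervalIntegral.integral_add (hf2.sub (hf.const_mul _)) (by simp),
      intervalIntegral.integral_sub hf2 (hf.const_mul _), intervalIntegral.integral_const_mul,
      intervalIntegral.integral_const, smul_eq_mul]
  have h2 : (∫ r in a..b, f r) = m * (b - a) := by rw [hm]; field_simp
  rw [h1, h2] at h0
  rw [h2]
  nlinarith

theorem delta_le_diam {d : ℕ} {Ω : Set (EuclideanSpace ℝ (Fin d))}
    {θ : EuclideanSpace ℝ (Fin d)} (ho : IsOpen Ω) (hb : Bornology.IsBounded Ω) (hθ : ‖θ‖ = 1)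
    (x : EuclideanSpace ℝ (Fin d)) : delta Ω θ x ≤ Metric.diam Ω := by
  refine le_of_forall_lt fun c hc => ?_
  rcases lt_or_ge c 0 with h | h
  · exact h.trans_le Metric.diam_nonneg
  obtain ⟨t, hct, hts⟩ := exists_between hc
  have hx := (lt_delta_iff ho hb hθ x (h.trans hct.le)).1 hts
  have h1 := Metric.dist_le_diam_of_mem hb (hx t ⟨h.trans hct.le, le_rfl⟩)
    (hx 0 ⟨le_rfl, h.trans hct.le⟩)
  rw [dist_add_left, zero_smul, dist_zero_right, norm_smul, hθ, mul_one,
    Real.norm_of_nonneg (h.trans hct.le)] at h1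
  exact hct.trans_le h1

namespace IsBorelRep

variable {d : ℕ} {Ω : Set (EuclideanSpace ℝ (Fin d))} {θ : EuclideanSpace ℝ (Fin d)}
  {U V : EuclideanSpace ℝ (Fin d) → ℝ}

theorem integrable_segment_sq (h : IsBorelRep Ω θ U V) :
    Integrable (fun x => ∫ r in (0 : ℝ)..Metric.diam Ω, V (x + r • θ) ^ 2) := by
  simp_rw [intervalIntegral.integral_of_le (Metric.diam_nonneg (s := Ω))]
  exact (integrable_comp_add_smul (V := fun x => V x ^ 2) (h.meas'.pow_const 2)
    h.memLp'.integrable_sq θ (volume.restrict (Ioc 0 (Metric.diam Ω)))).integral_prod_left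

theorem integral_segment_sq (h : IsBorelRep Ω θ U V) :
    ∫ x, (∫ r in (0 : ℝ)..Metric.diam Ω, V (x + r • θ) ^ 2)
      = Metric.diam Ω * ∫ x, V x ^ 2 := by
  simp_rw [intervalIntegral.integral_of_le (Metric.diam_nonneg (s := Ω))]
  rw [integral_integral_swap (f := fun x r => V (x + r • θ) ^ 2)
    (integrable_comp_add_smul (V := fun x => V x ^ 2) (h.meas'.pow_const 2)
    h.memLp'.integrable_sq θ (volume.restrict (Ioc 0 (Metric.diam Ω))))]
  simp_rw [integral_add_right_eq_self (fun x => V x ^ 2)]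
  simp [Metric.diam_nonneg]

/-- Lengthening the segment from `δ(x)` to `diam Ω` makes its length independent of `x`, so the
bound can be integrated by Fubini and translation. -/
theorem ae_sq_integral_le (h : IsBorelRep Ω θ U V) :
    ∀ᵐ x, (∫ r in (0 : ℝ)..delta Ω θ x, V (x + r • θ)) ^ 2
      ≤ Metric.diam Ω * ∫ r in (0 : ℝ)..Metric.diam Ω, V (x + r • θ) ^ 2 := by
  filter_upwards [ae_intervalIntegrable_comp_add_smul h.meas' h.integrable' θ,
    ae_intervalIntegrable_comp_add_smul (V := fun x => V x ^ 2) (h.meas'.pow_const 2)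
      h.memLp'.integrable_sq θ] with x h1 h2
  have hδ := delta_nonneg h.isBounded h.norm_eq x
  have hD := delta_le_diam h.isOpen h.isBounded h.norm_eq x
  refine (sq_intervalIntegral_le hδ (h1 _ _) (h2 _ _)).trans ?_
  rw [sub_zero]
  refine mul_le_mul hD ?_ (intervalIntegral.integral_nonneg hδ fun r _ => sq_nonneg _)
    Metric.diam_nonneg
  exact intervalIntegral.integral_mono_interval le_rfl hδ hD
    (Eventually.of_forall fun r => sq_nonneg _) (h2 _ _)

theorem setIntegral_sq_eq (h : IsBorelRep Ω θ U V) : ∫ x in Ω, U x ^ 2 = ∫ x, U x ^ 2 :=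
  setIntegral_eq_integral_of_forall_compl_eq_zero fun x hx => by simp [h.eq_zero x hx]

theorem setIntegral_segment_sq_le (h : IsBorelRep Ω θ U V) :
    ∫ x in Ω, (Metric.diam Ω * ∫ r in (0 : ℝ)..Metric.diam Ω, V (x + r • θ) ^ 2)
      ≤ Metric.diam Ω ^ 2 * ∫ x, V x ^ 2 := by
  rw [integral_const_mul, sq, mul_assoc, ← h.integral_segment_sq]
  refine mul_le_mul_of_nonneg_left (setIntegral_le_integral h.integrable_segment_sq
    (Eventually.of_forall fun x => ?_)) Metric.diam_nonneg
  exact intervalIntegral.integral_nonneg Metric.diam_nonneg fun r _ => sq_nonneg _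

theorem ae_restrict_sq_endValue_le (h : IsBorelRep Ω θ U V) :
    ∀ᵐ x ∂(volume.restrict Ω), endValue θ U (Phi Ω θ x) ^ 2 ≤ 2 * U x ^ 2
      + 2 * (Metric.diam Ω * ∫ r in (0 : ℝ)..Metric.diam Ω, V (x + r • θ) ^ 2) := by
  rw [ae_restrict_iff' h.isOpen.measurableSet]
  filter_upwards [h.ae_eq_endValue_sub, h.ae_sq_integral_le] with x h1 h2 hx
  have h3 : endValue θ U (Phi Ω θ x)
      = U x + ∫ r in (0 : ℝ)..delta Ω θ x, V (x + r • θ) := by linarith [h1 hx]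
  rw [h3]
  -- `(a + b)² ≤ 2a² + 2b²`, the difference being `(a - b)²`.
  nlinarith [sq_nonneg (U x - ∫ r in (0 : ℝ)..delta Ω θ x, V (x + r • θ))]

theorem integrable_bound (h : IsBorelRep Ω θ U V) :
    Integrable (fun x => 2 * U x ^ 2
      + 2 * (Metric.diam Ω * ∫ r in (0 : ℝ)..Metric.diam Ω, V (x + r • θ) ^ 2)) :=
  (h.memLp.integrable_sq.const_mul 2).add ((h.integrable_segment_sq.const_mul _).const_mul 2)

theorem integrableOn_sq_endValue (h : IsBorelRep Ω θ U V) :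
    IntegrableOn (fun x => endValue θ U (Phi Ω θ x) ^ 2) Ω := by
  refine Integrable.mono' h.integrable_bound.integrableOn ?_ ?_
  · exact (((measurable_endValue θ h.meas).comp
      (measurable_Phi h.isOpen h.isBounded h.norm_eq)).pow_const 2).aestronglyMeasurable
  · filter_upwards [h.ae_restrict_sq_endValue_le] with x hx
    rwa [Real.norm_of_nonneg (sq_nonneg _)]

theorem setIntegral_sq_endValue_le (h : IsBorelRep Ω θ U V) :
    ∫ x in Ω, endValue θ U (Phi Ω θ x) ^ 2
      ≤ 2 * (∫ x, U x ^ 2) + 2 * (Metric.diam Ω ^ 2 * ∫ x, V x ^ 2) := by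
  refine (integral_mono_ae h.integrableOn_sq_endValue h.integrable_bound.integrableOn
    h.ae_restrict_sq_endValue_le).trans ?_
  rw [integral_add (h.memLp.integrable_sq.const_mul 2).integrableOn
    ((h.integrable_segment_sq.const_mul _).const_mul 2).integrableOn, integral_const_mul,
    integral_const_mul, h.setIntegral_sq_eq]
  linarith [h.setIntegral_segment_sq_le]

/-- With zero end values `U` is minus the tail integral alone, so no factor `2` is lost. -/
theorem integral_sq_le_of_endValue_eq_zero (h : IsBorelRep Ω θ U V)
    (h0 : ∀ᵐ x ∂(volume.restrict Ω), endValue θ U (Phi Ω θ x) = 0) :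
    ∫ x, U x ^ 2 ≤ Metric.diam Ω ^ 2 * ∫ x, V x ^ 2 := by
  rw [← h.setIntegral_sq_eq]
  refine (integral_mono_ae h.memLp.integrable_sq.integrableOn
    (h.integrable_segment_sq.const_mul _).integrableOn ?_).trans h.setIntegral_segment_sq_le
  filter_upwards [ae_restrict_of_ae h.ae_eq_endValue_sub, ae_restrict_of_ae h.ae_sq_integral_le,
    h0, ae_restrict_mem h.isOpen.measurableSet] with x h1 h2 h3 hx
  rw [h1 hx, h3, zero_sub, neg_sq]
  exact h2

end IsBorelRep

/-! ### Primitives have weak derivatives in dimension one -/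

section OneDim

variable {v w : ℝ → ℝ} {a b : ℝ} {φ : ℝ → ℝ}

/-- On `[a, b]` the function `w` is absolutely continuous, so integration by parts against `φ` is
available. -/
theorem intervalIntegrable_and_integral_eq_of_primitive (hab : a ≤ b)
    (hv : IntervalIntegrable v volume a b)
    (hw : ∀ s ∈ Icc a b, w s - w a = ∫ r in a..s, v r) (hφ : ContDiff ℝ ∞ φ) :
    IntervalIntegrable (fun s => w s * fderiv ℝ φ s 1 + v s * φ s) volume a b ∧
      ∫ s in a..b, (w s * fderiv ℝ φ s 1 + v s * φ s) = w b * φ b - w a * φ a := by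
  set f : ℝ → ℝ := fun s => w a + ∫ r in a..s, v r with hf
  have hfw : ∀ s ∈ Icc a b, w s = f s := fun s hs => by rw [hf]; linarith [hw s hs]
  have hacI := hv.absolutelyContinuousOnInterval_intervalIntegral left_mem_uIcc
  have hac : AbsolutelyContinuousOnInterval f a b := by
    have hconst : AbsolutelyContinuousOnInterval (fun _ : ℝ => w a) a b :=
      ContDiffOn.absolutelyContinuousOnInterval contDiffOn_const
    exact hconst.add hacI
  have hacφ : AbsolutelyContinuousOnInterval φ a b :=
    ContDiffOn.absolutelyContinuousOnInterval (hφ.of_le (by simp)).contDiffOn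
  have hdf : ∀ᵐ s, s ∈ uIoc a b → deriv f s = v s := by
    filter_upwards [hv.ae_hasDerivAt_integral] with s hs hmem
    exact ((hs (uIoc_subset_uIcc hmem) a left_mem_uIcc).const_add (w a)).deriv
  have hcongr : ∀ᵐ s, s ∈ uIoc a b →
      w s * fderiv ℝ φ s 1 + v s * φ s = deriv f s * φ s + f s * deriv φ s := by
    filter_upwards [hdf] with s hs hmem
    rw [uIoc_of_le hab] at hmem
    rw [hs (by rwa [uIoc_of_le hab]), hfw s ⟨hmem.1.le, hmem.2⟩, fderiv_apply_one_eq_deriv]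
    ring
  constructor
  · refine IntervalIntegrable.congr_ae ?_ ((ae_restrict_iff' measurableSet_uIoc).2
      (hcongr.mono fun s hs hmem => (hs hmem).symm))
    exact (hac.intervalIntegrable_deriv.mul_continuousOn hacφ.continuousOn).add
      (hacφ.intervalIntegrable_deriv.continuousOn_mul hac.continuousOn)
  · rw [intervalIntegral.integral_congr_ae hcongr,
      AbsolutelyContinuousOnInterval.integral_deriv_mul_eq_sub hac hacφ,
      hfw b ⟨hab, le_rfl⟩, hfw a ⟨le_rfl, hab⟩]

/-- `O` may have infinitely many components, so the line is cut into cells shorter than the margin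
between `tsupport φ` and the complement of `O`. A cell meeting the support lies in `O` and allows
integration by parts; on the others everything vanishes. The boundary terms telescope. -/
theorem hasWeakDirDeriv_of_primitive {O : Set ℝ} (hO : IsOpen O)
    (hv : ∀ a b : ℝ, IntervalIntegrable v volume a b)
    (hw : ∀ a b : ℝ, a ≤ b → Icc a b ⊆ O → w b - w a = ∫ r in a..b, v r) :
    HasWeakDirDeriv O (1 : ℝ) w v := by
  intro φ hφ hc hsupp
  obtain ⟨ε, hε, hεO⟩ := hc.exists_cthickening_subset_open hO hsupp
  obtain ⟨R, hR⟩ := hc.isBounded.subset_closedBall (0 : ℝ)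
  -- The `+ 1` puts both extreme nodes strictly outside the support, where the telescoped sum
  -- vanishes.
  set p : ℕ → ℝ := fun k => -(|R| + 1) + k * ε with hp
  have hpsucc : ∀ k, p (k + 1) = p k + ε := fun k => by simp only [hp]; push_cast; ring
  obtain ⟨n, hn⟩ := exists_nat_gt (2 * (|R| + 1) / ε)
  have hpn : |R| + 1 < p n := by
    rw [div_lt_iff₀ hε] at hn; simp only [hp]; linarith
  have hp0 : p 0 = -(|R| + 1) := by simp [hp]
  have hK : ∀ s ∈ tsupport φ, p 0 < s ∧ s < p n := fun s hs => by
    have h1 := hR hs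
    rw [mem_closedBall_zero_iff, Real.norm_eq_abs, abs_le] at h1
    have h2 := le_abs_self R
    exact ⟨by linarith, by linarith⟩
  have hφ0 : ∀ s, s ∉ tsupport φ → φ s = 0 := fun s hs => image_eq_zero_of_notMem_tsupport hs
  have hφ'0 : ∀ s, s ∉ tsupport φ → fderiv ℝ φ s 1 = 0 := fun s hs => by
    rw [fderiv_of_notMem_tsupport ℝ hs]; rfl
  set h : ℝ → ℝ := fun s => w s * fderiv ℝ φ s 1 + v s * φ s with hh
  have hstep : ∀ k, IntervalIntegrable h volume (p k) (p (k + 1)) ∧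
      ∫ s in p k..p (k + 1), h s = w (p (k + 1)) * φ (p (k + 1)) - w (p k) * φ (p k) := by
    intro k
    have hle : p k ≤ p (k + 1) := by rw [hpsucc]; linarith
    by_cases hdisj : ∃ s ∈ Icc (p k) (p (k + 1)), s ∈ tsupport φ
    · obtain ⟨s₀, hs₀, hs₀K⟩ := hdisj
      have hsub : Icc (p k) (p (k + 1)) ⊆ O := fun s hs => by
        refine hεO (Metric.mem_cthickening_of_dist_le s s₀ ε _ hs₀K ?_)
        rw [hpsucc] at hs hs₀
        rw [Real.dist_eq, abs_le]
        exact ⟨by linarith [hs.1, hs₀.2], by linarith [hs.2, hs₀.1]⟩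
      exact intervalIntegrable_and_integral_eq_of_primitive hle (hv _ _)
        (fun s hs => hw _ _ hs.1 ((Icc_subset_Icc_right hs.2).trans hsub)) hφ
    · push Not at hdisj
      have h0 : ∀ s ∈ Icc (p k) (p (k + 1)), h s = 0 := fun s hs => by
        simp only [hh, hφ0 s (hdisj s hs), hφ'0 s (hdisj s hs), mul_zero, add_zero]
      have hcongr : EqOn (fun _ => (0 : ℝ)) h (uIoc (p k) (p (k + 1))) := fun s hs => by
        rw [uIoc_of_le hle] at hs
        exact (h0 s ⟨hs.1.le, hs.2⟩).symm
      refine ⟨(intervalIntegrable_const (c := (0 : ℝ))).congr hcongr, ?_⟩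
      rw [hφ0 _ (hdisj _ (right_mem_Icc.2 hle)), hφ0 _ (hdisj _ (left_mem_Icc.2 hle)),
        intervalIntegral.integral_congr (g := fun _ => 0) fun s hs => by
          rw [uIcc_of_le hle] at hs; exact h0 s hs]
      simp
  have hsum := intervalIntegral.sum_integral_adjacent_intervals (f := h) (μ := volume) (n := n)
    fun k _ => (hstep k).1
  rw [Finset.sum_congr rfl fun k _ => (hstep k).2,
    Finset.sum_range_sub (fun k => w (p k) * φ (p k)),
    hφ0 (p n) fun hmem => (hK _ hmem).2.false, hφ0 (p 0) fun hmem => (hK _ hmem).1.false] at hsum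
  have h0n : p 0 ≤ p n := by rw [hp0]; linarith [abs_nonneg R]
  have hih : IntervalIntegrable h volume (p 0) (p n) :=
    IntervalIntegrable.trans_iterate fun k _ => (hstep k).1
  have hivφ : IntervalIntegrable (fun s => v s * φ s) volume (p 0) (p n) :=
    (hv _ _).mul_continuousOn hφ.continuous.continuousOn
  have hiwφ : IntervalIntegrable (fun s => w s * fderiv ℝ φ s 1) volume (p 0) (p n) := by
    simpa [hh] using hih.sub hivφ
  have hconv : ∀ f : ℝ → ℝ, (∀ s ∉ tsupport φ, f s = 0) →
      ∫ s in O, f s = ∫ s in p 0..p n, f s := by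
    intro f hf
    rw [setIntegral_eq_integral_of_forall_compl_eq_zero fun s hs => hf s fun hs' => hs (hsupp hs'),
      intervalIntegral.integral_of_le h0n,
      setIntegral_eq_integral_of_forall_compl_eq_zero (s := Ioc (p 0) (p n)) fun s hs =>
        hf s fun hs' => hs ⟨(hK s hs').1, (hK s hs').2.le⟩]
  rw [hconv _ fun s hs => by rw [hφ'0 s hs, mul_zero],
    hconv _ fun s hs => by rw [hφ0 s hs, mul_zero], eq_neg_iff_add_eq_zero,
    ← intervalIntegral.integral_add hiwφ hivφ, ← hsum]
  simp

end OneDim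

/-! ### Slicing space into lines parallel to `θ` -/

section Lines

variable {d : ℕ} {Ω : Set (EuclideanSpace ℝ (Fin d))} {θ : EuclideanSpace ℝ (Fin d)}

/-- The parametrization of the space by `H_θ × ℝ`. -/
def lineMap (θ : EuclideanSpace ℝ (Fin d)) (p : Hyp θ × ℝ) : EuclideanSpace ℝ (Fin d) :=
  p.2 • θ + (p.1 : EuclideanSpace ℝ (Fin d))

/-- Since `θ` is a unit vector, `s ↦ sθ` is an isometry of `ℝ` onto its span; composed with the swap
and the orthogonal decomposition it gives `lineMap`. -/
theorem measurePreserving_lineMap (hθ : ‖θ‖ = 1) :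
    MeasurePreserving (lineMap θ) (volume.prod volume) volume := by
  have h1 : MeasurePreserving (Prod.map (LinearIsometryEquiv.toSpanUnitSingleton (𝕜 := ℝ) θ hθ)
      (id : Hyp θ → Hyp θ)) (volume.prod volume) (volume.prod volume) :=
    (LinearIsometryEquiv.measurePreserving _).prod (MeasurePreserving.id _)
  have h2 := ((Submodule.span ℝ {θ}).orthogonalDecomposition.symm.measurePreserving.comp
    (WithLp.volume_preserving_toLp (Submodule.span ℝ {θ}) (Hyp θ))).comp
    (h1.comp Measure.measurePreserving_swap)
  have heq : lineMap θ = ((Submodule.span ℝ {θ}).orthogonalDecomposition.symm ∘ WithLp.toLp 2) ∘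
      (Prod.map (LinearIsometryEquiv.toSpanUnitSingleton (𝕜 := ℝ) θ hθ)
        (id : Hyp θ → Hyp θ)) ∘ Prod.swap := by
    funext p
    simp [lineMap]
  rw [heq]
  exact h2

theorem ae_ae_line (hθ : ‖θ‖ = 1) {P : EuclideanSpace ℝ (Fin d) → Prop} (h : ∀ᵐ x, P x) :
    ∀ᵐ y : Hyp θ, ∀ᵐ s : ℝ, P (s • θ + (y : EuclideanSpace ℝ (Fin d))) :=
  Measure.ae_ae_of_ae_prod ((measurePreserving_lineMap hθ).quasiMeasurePreserving.ae h)

theorem ae_memLp_line (hθ : ‖θ‖ = 1) {f : EuclideanSpace ℝ (Fin d) → ℝ} (hfm : Measurable f)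
    (hf : MemLp f 2 volume) :
    ∀ᵐ y : Hyp θ, MemLp (fun s : ℝ => f (s • θ + (y : EuclideanSpace ℝ (Fin d)))) 2 volume := by
  have h := ((measurePreserving_lineMap hθ).integrable_comp
    hf.integrable_sq.aestronglyMeasurable).2 hf.integrable_sq
  filter_upwards [h.prod_right_ae] with y hy
  refine (memLp_two_iff_integrable_sq ?_).2 hy
  exact (hfm.comp ((measurable_id.smul_const θ).add_const _)).aestronglyMeasurable

theorem proj_lineMap (y : Hyp θ) (s : ℝ) :
    (Hyp θ).orthogonalProjectionOnto (s • θ + (y : EuclideanSpace ℝ (Fin d))) = y := by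
  rw [map_add, Submodule.orthogonalProjectionOnto_mem_subspace_eq_self]
  simp

theorem exists_line (x : EuclideanSpace ℝ (Fin d)) :
    ∃ s : ℝ, x = s • θ +
      ((Hyp θ).orthogonalProjectionOnto x : EuclideanSpace ℝ (Fin d)) := by
  have h := Submodule.sub_starProjection_mem_orthogonal (K := Hyp θ) x
  rw [Submodule.orthogonal_orthogonal] at h
  obtain ⟨s, hs⟩ := Submodule.mem_span_singleton.1 h
  refine ⟨s, ?_⟩
  rw [hs, Submodule.starProjection_apply, sub_add_cancel]

theorem measurable_proj :
    Measurable fun x : EuclideanSpace ℝ (Fin d) => (Hyp θ).orthogonalProjectionOnto x :=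
  (Hyp θ).orthogonalProjectionOnto.continuous.measurable

/-- In the coordinates of `lineMap` the preimage of `B` is `B × ℝ`, which is null when `B` is. -/
theorem quasiMeasurePreserving_proj (hθ : ‖θ‖ = 1) : Measure.QuasiMeasurePreserving
    (fun x : EuclideanSpace ℝ (Fin d) => (Hyp θ).orthogonalProjectionOnto x) volume volume := by
  refine ⟨measurable_proj, Measure.AbsolutelyContinuous.mk fun B hB h0 => ?_⟩
  rw [Measure.map_apply measurable_proj hB,
    ← (measurePreserving_lineMap hθ).measure_preimage (measurable_proj hB).nullMeasurableSet]
  have : lineMap θ ⁻¹' ((fun x => (Hyp θ).orthogonalProjectionOnto x) ⁻¹' B)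
      = Prod.fst ⁻¹' B := by
    ext p
    simp only [mem_preimage, lineMap, proj_lineMap]
  rw [this]
  exact Measure.quasiMeasurePreserving_fst.preimage_null h0

theorem isOpen_omega (ho : IsOpen Ω) (y : Hyp θ) : IsOpen (omega Ω θ y) :=
  ho.preimage (f := fun s : ℝ => s • θ + (y : EuclideanSpace ℝ (Fin d))) (by fun_prop)

theorem delta_line (ho : IsOpen Ω) (hb : Bornology.IsBounded Ω) (hθ : ‖θ‖ = 1) {y : Hyp θ}
    {s β : ℝ} (hsβ : s < β) (hsub : Ico s β ⊆ omega Ω θ y) (hβ : β ∉ omega Ω θ y) :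
    delta Ω θ (s • θ + (y : EuclideanSpace ℝ (Fin d))) = β - s := by
  have hadd : ∀ t : ℝ, s • θ + (y : EuclideanSpace ℝ (Fin d)) + t • θ
      = (s + t) • θ + (y : EuclideanSpace ℝ (Fin d)) := fun t => by rw [add_smul]; abel
  refine le_antisymm (not_lt.1 fun hlt => hβ ?_) (le_of_forall_lt fun c hc => ?_)
  · have := (lt_delta_iff ho hb hθ _ (sub_nonneg.2 hsβ.le)).1 hlt (β - s)
      ⟨sub_nonneg.2 hsβ.le, le_rfl⟩
    rwa [hadd, add_sub_cancel] at this
  · refine (le_max_left c 0).trans_lt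
      ((lt_delta_iff ho hb hθ _ (le_max_right c 0)).2 fun t ht => ?_)
    rw [hadd]
    refine hsub ⟨by linarith [ht.1], ?_⟩
    have : max c 0 < β - s := max_lt hc (sub_pos.2 hsβ)
    linarith [ht.2]

theorem Phi_line (ho : IsOpen Ω) (hb : Bornology.IsBounded Ω) (hθ : ‖θ‖ = 1) {y : Hyp θ}
    {s β : ℝ} (hsβ : s < β) (hsub : Ico s β ⊆ omega Ω θ y) (hβ : β ∉ omega Ω θ y) :
    Phi Ω θ (s • θ + (y : EuclideanSpace ℝ (Fin d)))
      = β • θ + (y : EuclideanSpace ℝ (Fin d)) := by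
  rw [Phi, delta_line ho hb hθ hsβ hsub hβ, sub_smul]; abel

/-- Every point of `ω_θ(y)` has an exit point to its right. -/
theorem exists_exit (ho : IsOpen Ω) (hb : Bornology.IsBounded Ω) (hθ : ‖θ‖ = 1) {y : Hyp θ}
    {s : ℝ} (hs : s ∈ omega Ω θ y) :
    ∃ β, s < β ∧ Ico s β ⊆ omega Ω θ y ∧ β ∉ omega Ω θ y := by
  set x := s • θ + (y : EuclideanSpace ℝ (Fin d)) with hx
  have hadd : ∀ t : ℝ, x + t • θ
      = (s + t) • θ + (y : EuclideanSpace ℝ (Fin d)) := fun t => by rw [hx, add_smul]; abel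
  refine ⟨s + delta Ω θ x, by linarith [delta_pos ho hb hθ (x := x) hs], fun t ht => ?_,
    fun hmem => ?_⟩
  · have := (lt_delta_iff ho hb hθ x (c := t - s) (by linarith [ht.1])).1 (by linarith [ht.2])
      (t - s) ⟨by linarith [ht.1], le_rfl⟩
    rwa [hadd, add_sub_cancel] at this
  · have h1 := Phi_mem_frontier ho hb hθ (x := x) hs
    rw [ho.frontier_eq] at h1
    refine h1.2 ?_
    rw [Phi, hadd]
    exact hmem

end Lines

/-! ### Chords and the directional measure -/

variable {d : ℕ} {Ω : Set (EuclideanSpace ℝ (Fin d))} {θ : EuclideanSpace ℝ (Fin d)}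

theorem continuous_integral_left {f : ℝ → ℝ} (hf : ∀ a b : ℝ, IntervalIntegrable f volume a b)
    (b : ℝ) : Continuous fun s => ∫ r in s..b, f r := by
  simp_rw [fun s : ℝ => intervalIntegral.integral_symm (μ := volume) (f := f) b s]
  exact (intervalIntegral.continuous_primitive hf b).neg

/-- Every point of `ω_θ(y)` has an entry point to its left. -/
theorem exists_entry (ho : IsOpen Ω) (hb : Bornology.IsBounded Ω) (hθ : ‖θ‖ = 1) {y : Hyp θ}
    {s : ℝ} (hs : s ∈ omega Ω θ y) :
    ∃ α, α < s ∧ Ioc α s ⊆ omega Ω θ y ∧ α ∉ omega Ω θ y := by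
  -- An entry point for `θ` is an exit point for `-θ`.
  have hθ' : ‖-θ‖ = 1 := by rwa [norm_neg]
  set x := s • θ + (y : EuclideanSpace ℝ (Fin d)) with hx
  have hadd : ∀ t : ℝ, x + t • (-θ)
      = (s - t) • θ + (y : EuclideanSpace ℝ (Fin d)) := fun t => by
    rw [hx, sub_smul, smul_neg]; abel
  refine ⟨s - delta Ω (-θ) x, by linarith [delta_pos ho hb hθ' (x := x) hs], fun t ht => ?_,
    fun hmem => ?_⟩
  · have := (lt_delta_iff ho hb hθ' x (c := s - t) (by linarith [ht.2])).1 (by linarith [ht.1])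
      (s - t) ⟨by linarith [ht.2], le_rfl⟩
    rwa [hadd, sub_sub_cancel] at this
  · have h1 := Phi_mem_frontier ho hb hθ' (x := x) hs
    rw [ho.frontier_eq] at h1
    refine h1.2 ?_
    rw [Phi, hadd]
    exact hmem

theorem exists_isChord (ho : IsOpen Ω) (hb : Bornology.IsBounded Ω) (hθ : ‖θ‖ = 1) {y : Hyp θ}
    {s : ℝ} (hs : s ∈ omega Ω θ y) :
    ∃ α β, IsChord Ω θ y α β ∧ Phi Ω θ (s • θ + (y : EuclideanSpace ℝ (Fin d)))
      = β • θ + (y : EuclideanSpace ℝ (Fin d)) := by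
  obtain ⟨β, hsβ, hsub, hβ⟩ := exists_exit ho hb hθ hs
  obtain ⟨α, hαs, hsub', hα⟩ := exists_entry ho hb hθ hs
  refine ⟨α, β, ⟨hαs.trans hsβ, fun t ht => ?_, hα, hβ⟩, Phi_line ho hb hθ hsβ hsub hβ⟩
  rcases le_or_gt t s with h | h
  · exact hsub' ⟨ht.1, h⟩
  · exact hsub ⟨h.le, ht.2⟩

theorem IsChord.Ico_subset {y : Hyp θ} {α β s : ℝ} (h : IsChord Ω θ y α β) (hs : s ∈ Ioo α β) :
    Ico s β ⊆ omega Ω θ y := fun _ ht => h.2.1 ⟨hs.1.trans_le ht.1, ht.2⟩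

theorem IsChord.Phi_eq {y : Hyp θ} {α β s : ℝ} (ho : IsOpen Ω) (hb : Bornology.IsBounded Ω)
    (hθ : ‖θ‖ = 1) (h : IsChord Ω θ y α β) (hs : s ∈ Ioo α β) :
    Phi Ω θ (s • θ + (y : EuclideanSpace ℝ (Fin d)))
      = β • θ + (y : EuclideanSpace ℝ (Fin d)) :=
  Phi_line ho hb hθ hs.2 (h.Ico_subset hs) h.2.2.2

theorem IsChord.neBot {y : Hyp θ} {α β : ℝ} (h : IsChord Ω θ y α β) :
    NeBot (ae (volume.restrict (Ioo α β))) := by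
  rw [ae_neBot, Ne, Measure.restrict_eq_zero, Real.volume_Ioo, ENNReal.ofReal_eq_zero]
  linarith [h.1]

/-- Restricting to `∂Ω` loses no mass, as `Φ` sends `Ω` into `∂Ω`. Integrals for `μ_θ` thereby
become integrals over `Ω`. -/
theorem map_val_dirMeasure (ho : IsOpen Ω) (hb : Bornology.IsBounded Ω) (hθ : ‖θ‖ = 1) :
    (dirMeasure Ω θ).map Subtype.val
      = (volume.restrict Ω).map (Phi Ω θ) := by
  have hF : MeasurableSet (frontier Ω) := isClosed_frontier.measurableSet
  rw [dirMeasure, (MeasurableEmbedding.subtype_coe hF).map_comap, Subtype.range_coe]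
  refine Measure.restrict_eq_self_of_ae_mem ?_
  refine (ae_map_iff (p := fun z => z ∈ frontier Ω) (measurable_Phi ho hb hθ).aemeasurable hF).2 ?_
  filter_upwards [ae_restrict_mem ho.measurableSet] with x hx
  exact Phi_mem_frontier ho hb hθ hx

theorem proj_Phi (x : EuclideanSpace ℝ (Fin d)) :
    (Hyp θ).orthogonalProjectionOnto (Phi Ω θ x) = (Hyp θ).orthogonalProjectionOnto x := by
  rw [Phi, map_add]
  simp

/-- `Φ` moves points only along `θ`, so `μ_θ` and Lebesgue measure on `Ω` have the same projection
on `H_θ`. Exceptional null sets of lines are therefore invisible to `μ_θ`. -/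
theorem ae_dirMeasure_proj (ho : IsOpen Ω) (hb : Bornology.IsBounded Ω) (hθ : ‖θ‖ = 1)
    {R : Hyp θ → Prop} (hR : ∀ᵐ y, R y) :
    ∀ᵐ z : frontier Ω ∂(dirMeasure Ω θ),
      R ((Hyp θ).orthogonalProjectionOnto (z : EuclideanSpace ℝ (Fin d))) := by
  refine ae_of_ae_map measurable_subtype_coe.aemeasurable
    (p := fun z => R ((Hyp θ).orthogonalProjectionOnto z)) ?_
  rw [map_val_dirMeasure ho hb hθ]
  refine ae_of_ae_map measurable_proj.aemeasurable (p := R) ?_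
  rw [Measure.map_map measurable_proj (measurable_Phi ho hb hθ)]
  have : (fun x => (Hyp θ).orthogonalProjectionOnto x) ∘ Phi Ω θ
      = fun x => (Hyp θ).orthogonalProjectionOnto x := funext fun x => proj_Phi x
  rw [this]
  exact (Measure.absolutelyContinuous_of_le Measure.restrict_le_self).map measurable_proj
    |>.trans (quasiMeasurePreserving_proj hθ).absolutelyContinuous |>.ae_le hR

/-- `μ_θ` is carried by `Φ_θ(Ω)`. -/
theorem ae_dirMeasure_mem_image (ho : IsOpen Ω) (hb : Bornology.IsBounded Ω) (hθ : ‖θ‖ = 1) :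
    ∀ᵐ z : frontier Ω ∂(dirMeasure Ω θ), ∃ x ∈ Ω, Phi Ω θ x = z := by
  have hΦ := measurable_Phi ho hb hθ
  -- Stepping back from `z` by `1 / (n + 1)` replaces the existence of a preimage by a countable
  -- union of Borel conditions, as `ae_map_iff` requires measurability.
  have key : ∀ᵐ z ∂(volume.restrict Ω).map (Phi Ω θ),
      ∃ n : ℕ, z - (1 / ((n : ℝ) + 1)) • θ ∈ Ω ∧
        Phi Ω θ (z - (1 / ((n : ℝ) + 1)) • θ) = z := by
    rw [ae_map_iff hΦ.aemeasurable]
    · filter_upwards [ae_restrict_mem ho.measurableSet] with x hx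
      obtain ⟨s, hs⟩ := exists_line (θ := θ) x
      set y := (Hyp θ).orthogonalProjectionOnto x
      have hsω : s ∈ omega Ω θ y := by rw [omega, mem_ofPred_eq, ← hs]; exact hx
      obtain ⟨β, hsβ, hsub, hβ⟩ := exists_exit ho hb hθ hsω
      obtain ⟨n, hn⟩ := exists_nat_one_div_lt (sub_pos.2 hsβ)
      have hpos : 0 < 1 / ((n : ℝ) + 1) := by positivity
      have hΦx : Phi Ω θ x = β • θ + (y : EuclideanSpace ℝ (Fin d)) := by
        rw [hs, Phi_line ho hb hθ hsβ hsub hβ]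
      have heq : Phi Ω θ x - (1 / ((n : ℝ) + 1)) • θ
          = (β - 1 / ((n : ℝ) + 1)) • θ + (y : EuclideanSpace ℝ (Fin d)) := by
        rw [hΦx, sub_smul]; abel
      refine ⟨n, ?_, ?_⟩
      · rw [heq]
        exact hsub (a := β - 1 / ((n : ℝ) + 1)) ⟨by linarith, by linarith⟩
      · rw [heq, Phi_line ho hb hθ (by linarith)
          (fun t ht => hsub ⟨by linarith [ht.1], ht.2⟩) hβ]
        exact hΦx.symm
    · have : {z : EuclideanSpace ℝ (Fin d) | ∃ n : ℕ, z - (1 / ((n : ℝ) + 1)) • θ ∈ Ω ∧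
          Phi Ω θ (z - (1 / ((n : ℝ) + 1)) • θ) = z}
          = ⋃ n : ℕ, {z | z - (1 / ((n : ℝ) + 1)) • θ ∈ Ω ∧
            Phi Ω θ (z - (1 / ((n : ℝ) + 1)) • θ) = z} := by
        ext z; simp
      rw [this]
      refine MeasurableSet.iUnion fun n => ?_
      have hm : Measurable fun z : EuclideanSpace ℝ (Fin d) => z - (1 / ((n : ℝ) + 1)) • θ :=
        measurable_id.sub_const _
      exact (hm ho.measurableSet).inter (measurableSet_eq_fun (hΦ.comp hm) measurable_id)
  rw [← map_val_dirMeasure ho hb hθ] at key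
  filter_upwards [ae_of_ae_map measurable_subtype_coe.aemeasurable key] with z hz
  obtain ⟨n, hn, hn'⟩ := hz
  exact ⟨_, hn, hn'⟩

/-! ### The traces are the functions a.e. equal to the end value -/

namespace IsBorelRep

variable {U V : EuclideanSpace ℝ (Fin d) → ℝ}

/-- On a fixed chord the right side is a constant minus a tail integral with fixed endpoint `β`,
visibly continuous in `s` up to `β`. -/
theorem endValue_sub_integral_line (h : IsBorelRep Ω θ U V) {y : Hyp θ}
    {s β : ℝ} (hsβ : s < β) (hsub : Ico s β ⊆ omega Ω θ y) (hβ : β ∉ omega Ω θ y) :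
    endValue θ U (Phi Ω θ (s • θ + (y : EuclideanSpace ℝ (Fin d))))
        - ∫ r in (0 : ℝ)..delta Ω θ (s • θ + (y : EuclideanSpace ℝ (Fin d))),
          V (s • θ + (y : EuclideanSpace ℝ (Fin d)) + r • θ)
      = endValue θ U (β • θ + (y : EuclideanSpace ℝ (Fin d)))
        - ∫ r in s..β, V (r • θ + (y : EuclideanSpace ℝ (Fin d))) := by
  rw [Phi_line h.isOpen h.isBounded h.norm_eq hsβ hsub hβ,
    delta_line h.isOpen h.isBounded h.norm_eq hsβ hsub hβ]
  have := intervalIntegral.integral_comp_add_left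
    (fun r : ℝ => V (r • θ + (y : EuclideanSpace ℝ (Fin d)))) (a := 0) (b := β - s) s
  rw [add_zero, add_sub_cancel] at this
  rw [← this]
  congr 1
  refine intervalIntegral.integral_congr fun r _ => congrArg V ?_
  rw [add_smul]; abel

theorem ae_line_intervalIntegrable (h : IsBorelRep Ω θ U V) :
    ∀ᵐ y : Hyp θ, ∀ a b : ℝ, IntervalIntegrable
      (fun r : ℝ => V (r • θ + (y : EuclideanSpace ℝ (Fin d)))) volume a b := by
  filter_upwards [ae_memLp_line h.norm_eq h.meas' h.memLp'] with y hy a b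
  rw [intervalIntegrable_iff]
  have : IsFiniteMeasure (volume.restrict (uIoc a b)) :=
    isFiniteMeasure_restrict.2 (by simp [uIoc])
  exact (hy.restrict _).integrable (by norm_num)

theorem isDirTrace (h : IsBorelRep Ω θ U V) {u : L2 Ω} (hu : U =ᵐ[volume.restrict Ω] u)
    {g : frontier Ω → ℝ}
    (hg : ∀ᵐ x ∂(volume.restrict Ω), ∀ hz : Phi Ω θ x ∈ frontier Ω,
      g ⟨Phi Ω θ x, hz⟩ = endValue θ U (Phi Ω θ x)) :
    IsDirTrace Ω θ u g := by
  have ho := h.isOpen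
  have hb := h.isBounded
  have hθ := h.norm_eq
  rw [ae_restrict_iff' ho.measurableSet] at hg
  have hall := (((ae_memLp_line hθ h.meas h.memLp).and (ae_memLp_line hθ h.meas' h.memLp')).and
    h.ae_line_intervalIntegrable).and (ae_ae_line hθ (h.ae_eq_endValue_sub.and hg))
  refine ⟨U, hu, {y | y ∈ proj Ω θ ∧ _}, fun y hy => hy.1,
    measure_mono_null (fun y hy hQ => hy.2 ⟨hy.1, hQ⟩) (ae_iff.1 hall), ?_⟩
  rintro y ⟨-, ⟨⟨hU, hV⟩, hVi⟩, hline⟩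
  constructor
  · refine ⟨hU.restrict _, _, hV.restrict _, ?_⟩
    -- `w` is the precise version of `U` on the line: the primitive relation holds for it at every
    -- point of `ω_θ(y)`, and `U` equals it a.e. there.
    set w : ℝ → ℝ := fun s =>
      endValue θ U (Phi Ω θ (s • θ + (y : EuclideanSpace ℝ (Fin d))))
        - ∫ r in (0 : ℝ)..delta Ω θ (s • θ + (y : EuclideanSpace ℝ (Fin d))),
          V (s • θ + (y : EuclideanSpace ℝ (Fin d)) + r • θ) with hw
    have hweak := hasWeakDirDeriv_of_primitive (w := w) (isOpen_omega ho y) hVi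
      (fun a b hab hsub => by
        -- The exit point of `b` is also that of `a`, so the end values cancel in `w b - w a`.
        obtain ⟨β, hbβ, hsubβ, hβ⟩ := exists_exit ho hb hθ (hsub ⟨hab, le_rfl⟩)
        have ha : Ico a β ⊆ omega Ω θ y := fun t ht => by
          rcases le_or_gt t b with htb | htb
          · exact hsub ⟨ht.1, htb⟩
          · exact hsubβ ⟨htb.le, ht.2⟩
        rw [hw]
        simp only
        rw [h.endValue_sub_integral_line hbβ hsubβ hβ,
          h.endValue_sub_integral_line (hab.trans_lt hbβ) ha hβ,
          ← intervalIntegral.integral_add_adjacent_intervals (hVi a b) (hVi b β)]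
        ring)
    intro φ hφ hc hs
    rw [← hweak φ hφ hc hs]
    refine setIntegral_congr_ae (isOpen_omega ho y).measurableSet ?_
    filter_upwards [hline] with s hs hsω
    rw [hs.1 hsω]
  · intro α β hchord
    have hneBot := hchord.neBot
    have hae : ∀ᵐ s ∂(volume.restrict (Ioo α β)), s ∈ Ioo α β ∧
        U (s • θ + (y : EuclideanSpace ℝ (Fin d)))
          = endValue θ U (β • θ + (y : EuclideanSpace ℝ (Fin d)))
            - ∫ r in s..β, V (r • θ + (y : EuclideanSpace ℝ (Fin d))) ∧
        ∀ hz : β • θ + (y : EuclideanSpace ℝ (Fin d)) ∈ frontier Ω,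
          g ⟨_, hz⟩ = endValue θ U (β • θ + (y : EuclideanSpace ℝ (Fin d))) := by
      filter_upwards [ae_restrict_of_ae hline, ae_restrict_mem measurableSet_Ioo] with s hs hmem
      obtain ⟨hs1, hs2⟩ := hs
      have hsω := hchord.2.1 hmem
      refine ⟨hmem, ?_, ?_⟩
      · rw [← h.endValue_sub_integral_line hmem.2 (hchord.Ico_subset hmem) hchord.2.2.2]
        exact hs1 hsω
      · have := hs2 hsω
        rwa [hchord.Phi_eq ho hb hθ hmem] at this
    -- The claim about `g` does not depend on `s`, so one good point of the chord suffices.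
    obtain ⟨s, hs, -, hsg⟩ := hae.exists
    have hz : β • θ + (y : EuclideanSpace ℝ (Fin d)) ∈ frontier Ω := by
      rw [← hchord.Phi_eq ho hb hθ hs]
      exact Phi_mem_frontier ho hb hθ (hchord.2.1 hs)
    refine ⟨fun s => endValue θ U (β • θ + (y : EuclideanSpace ℝ (Fin d)))
      - ∫ r in s..β, V (r • θ + (y : EuclideanSpace ℝ (Fin d))), ?_,
      hae.mono fun s hs => hs.2.1.symm, hz, by simp [hsg hz]⟩
    exact (continuous_const.sub (continuous_integral_left hVi β)).continuousOn

/-- Whatever the representative `v`, on almost every line it agrees a.e. with `U`. The continuous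
`f` of the trace then equals the end value minus the tail integral a.e. on the chord, hence
everywhere on `(α, β]`, in particular at `β`. -/
theorem ae_eq_of_isDirTrace (h : IsBorelRep Ω θ U V) {u : L2 Ω}
    (hu : U =ᵐ[volume.restrict Ω] u) {g : frontier Ω → ℝ} (hg : IsDirTrace Ω θ u g) :
    ∀ᵐ z : frontier Ω ∂(dirMeasure Ω θ), g z = endValue θ U z := by
  have ho := h.isOpen
  have hb := h.isBounded
  have hθ := h.norm_eq
  obtain ⟨v, hv, A, -, hA, hgA⟩ := hg
  have hvU := (ae_restrict_iff' ho.measurableSet).1 (hv.trans hu.symm)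
  have hA' : ∀ᵐ y : Hyp θ, y ∈ proj Ω θ → y ∈ A := by
    rw [ae_iff]
    convert hA using 2
    ext y; simp
  filter_upwards [ae_dirMeasure_mem_image ho hb hθ, ae_dirMeasure_proj ho hb hθ
    ((hA'.and h.ae_line_intervalIntegrable).and
      (ae_ae_line hθ (h.ae_eq_endValue_sub.and hvU)))] with z hz hy
  obtain ⟨x, hx, hxz⟩ := hz
  rw [← hxz, proj_Phi] at hy
  obtain ⟨s, hs⟩ := exists_line (θ := θ) x
  set y := (Hyp θ).orthogonalProjectionOnto x
  obtain ⟨⟨hyA, hVi⟩, hline⟩ := hy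
  have hsω : s ∈ omega Ω θ y := by rw [omega, mem_ofPred_eq, ← hs]; exact hx
  obtain ⟨α, β, hchord, hΦ⟩ := exists_isChord ho hb hθ hsω
  rw [← hs, hxz] at hΦ
  obtain ⟨f, hfc, hfv, hzβ, hgf⟩ := (hgA y (hyA ⟨x, hx, rfl⟩)).2 α β hchord
  have hcont : Continuous fun s => endValue θ U (β • θ + (y : EuclideanSpace ℝ (Fin d)))
      - ∫ r in s..β, V (r • θ + (y : EuclideanSpace ℝ (Fin d))) :=
    continuous_const.sub (continuous_integral_left hVi β)
  have hff : f =ᵐ[volume.restrict (Ioc α β)] fun s =>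
      endValue θ U (β • θ + (y : EuclideanSpace ℝ (Fin d)))
      - ∫ r in s..β, V (r • θ + (y : EuclideanSpace ℝ (Fin d))) := by
    rw [← Measure.restrict_congr_set Ioo_ae_eq_Ioc]
    filter_upwards [hfv, ae_restrict_of_ae hline, ae_restrict_mem measurableSet_Ioo]
      with t ht htl hmem
    have htω := hchord.2.1 hmem
    rw [ht, htl.2 htω, htl.1 htω,
      h.endValue_sub_integral_line hmem.2 (hchord.Ico_subset hmem) hchord.2.2.2]
  have hfβ := Measure.eqOn_Ioc_of_ae_eq volume hff hfc hcont.continuousOn (right_mem_Ioc.2 hchord.1)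
  simp only [intervalIntegral.integral_same, sub_zero] at hfβ
  have hzeq : z = ⟨_, hzβ⟩ := Subtype.ext hΦ
  rw [hzeq, hgf, hfβ]

theorem memLp_endValue (h : IsBorelRep Ω θ U V) :
    MemLp (fun z : frontier Ω => endValue θ U z) 2 (dirMeasure Ω θ) := by
  have hm := measurable_endValue θ h.meas
  have hΦ := measurable_Phi h.isOpen h.isBounded h.norm_eq
  refine (memLp_map_measure_iff (g := endValue θ U) hm.aestronglyMeasurable
    measurable_subtype_coe.aemeasurable).1 ?_
  rw [map_val_dirMeasure h.isOpen h.isBounded h.norm_eq,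
    memLp_map_measure_iff hm.aestronglyMeasurable hΦ.aemeasurable,
    memLp_two_iff_integrable_sq (hm.comp hΦ).aestronglyMeasurable]
  exact h.integrableOn_sq_endValue

theorem integral_sq_endValue_dirMeasure (h : IsBorelRep Ω θ U V) :
    ∫ z, endValue θ U (z : EuclideanSpace ℝ (Fin d)) ^ 2 ∂(dirMeasure Ω θ)
      = ∫ x in Ω, endValue θ U (Phi Ω θ x) ^ 2 := by
  have hm : Measurable fun z => endValue θ U z ^ 2 := (measurable_endValue θ h.meas).pow_const 2
  rw [← integral_map (measurable_Phi h.isOpen h.isBounded h.norm_eq).aemeasurable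
      (f := fun z => endValue θ U z ^ 2) hm.aestronglyMeasurable,
    ← map_val_dirMeasure h.isOpen h.isBounded h.norm_eq,
    integral_map measurable_subtype_coe.aemeasurable hm.aestronglyMeasurable]

theorem ae_restrict_of_ae_dirMeasure (h : IsBorelRep Ω θ U V) {g : frontier Ω → ℝ}
    (hg : ∀ᵐ z : frontier Ω ∂(dirMeasure Ω θ), g z = endValue θ U z) :
    ∀ᵐ x ∂(volume.restrict Ω), ∀ hz : Phi Ω θ x ∈ frontier Ω,
      g ⟨Phi Ω θ x, hz⟩ = endValue θ U (Phi Ω θ x) := by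
  have hF : MeasurableSet (frontier Ω) := isClosed_frontier.measurableSet
  have h1 : ∀ᵐ z ∂(dirMeasure Ω θ).map Subtype.val, ∀ hz : z ∈ frontier Ω,
      g ⟨z, hz⟩ = endValue θ U z := by
    rw [(MeasurableEmbedding.subtype_coe hF).ae_map_iff]
    exact hg.mono fun z hz _ => hz
  rw [map_val_dirMeasure h.isOpen h.isBounded h.norm_eq] at h1
  exact ae_of_ae_map (measurable_Phi h.isOpen h.isBounded h.norm_eq).aemeasurable h1

end IsBorelRep

/-! ### From classes in `L²(Ω)` to Borel representatives, and conclusion -/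

theorem norm_sq_eq_integral (ho : IsOpen Ω) (u : L2 Ω) :
    ‖u‖ ^ 2 = ∫ x, Ω.indicator u x ^ 2 := by
  have h1 : (fun x => Ω.indicator u x ^ 2) = Ω.indicator fun x => u x ^ 2 := by
    ext x; by_cases hx : x ∈ Ω <;> simp [hx]
  rw [h1, integral_indicator ho.measurableSet, ← real_inner_self_eq_norm_sq, L2.inner_def]
  refine integral_congr_ae (Eventually.of_forall fun x => ?_)
  simp [sq]

theorem isBorelRep_indicator (ho : IsOpen Ω) (hb : Bornology.IsBounded Ω) (hθ : ‖θ‖ = 1)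
    {u v : L2 Ω} (hw : HasWeakDirDeriv Ω θ u v) :
    IsBorelRep Ω θ (Ω.indicator u) (Ω.indicator v) where
  isOpen := ho
  isBounded := hb
  norm_eq := hθ
  meas := (Lp.stronglyMeasurable u).measurable.indicator ho.measurableSet
  meas' := (Lp.stronglyMeasurable v).measurable.indicator ho.measurableSet
  memLp := (memLp_indicator_iff_restrict ho.measurableSet).2 (Lp.memLp u)
  memLp' := (memLp_indicator_iff_restrict ho.measurableSet).2 (Lp.memLp v)
  eq_zero _ hx := indicator_of_notMem hx _
  eq_zero' _ hx := indicator_of_notMem hx _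
  weak φ hφ hc hs := by
    have h := hw φ hφ hc hs
    rw [← integral_indicator ho.measurableSet, ← integral_indicator ho.measurableSet] at h
    simpa only [indicator_mul_left] using h

end DirTrace

theorem mainTheorem9 {d : ℕ} (Ω : Set (EuclideanSpace ℝ (Fin d))) (hΩ : IsOpen Ω)
    (hb : Bornology.IsBounded Ω) (θ : EuclideanSpace ℝ (Fin d)) (hθ : ‖θ‖ = 1)
    (u : DirTrace.L2 Ω) (hu : u ∈ DirTrace.W Ω θ) :
    ∃ G : Lp ℝ 2 (DirTrace.dirMeasure Ω θ),
      DirTrace.dirTrace Ω θ u = {g | g =ᵐ[DirTrace.dirMeasure Ω θ] G} ∧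
      ∫ z, (G z) ^ 2 ∂(DirTrace.dirMeasure Ω θ) ≤
        2 * max 1 (Metric.diam Ω ^ 2) * DirTrace.normW Ω θ u ^ 2 ∧
      (G = 0 → ‖u‖ ≤ Metric.diam Ω * ‖DirTrace.dirDeriv Ω θ u‖) := by
  have hw : DirTrace.HasWeakDirDeriv Ω θ u (DirTrace.dirDeriv Ω θ u) := by
    have hu' : ∃ v : DirTrace.L2 Ω, DirTrace.HasWeakDirDeriv Ω θ u v := hu
    rw [DirTrace.dirDeriv, dif_pos hu']
    exact hu'.choose_spec
  set v := DirTrace.dirDeriv Ω θ u with hv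
  have h := DirTrace.isBorelRep_indicator hΩ hb hθ hw
  have hUu : Ω.indicator u =ᵐ[volume.restrict Ω] u := indicator_ae_eq_restrict hΩ.measurableSet
  have hG := h.memLp_endValue.coeFn_toLp
  refine ⟨h.memLp_endValue.toLp, ?_, ?_, fun hG0 => ?_⟩
  · ext g
    refine ⟨fun hg => ?_, fun hg => ?_⟩
    · exact EventuallyEq.trans (h.ae_eq_of_isDirTrace hUu hg) hG.symm
    · exact h.isDirTrace hUu (h.ae_restrict_of_ae_dirMeasure (EventuallyEq.trans hg hG))
  · rw [integral_congr_ae (hG.mono fun z hz => by rw [hz]), h.integral_sq_endValue_dirMeasure]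
    refine h.setIntegral_sq_endValue_le.trans ?_
    rw [← DirTrace.norm_sq_eq_integral hΩ, ← DirTrace.norm_sq_eq_integral hΩ, DirTrace.normW,
      Real.sq_sqrt (by positivity), ← hv]
    -- The bound `2‖u‖² + 2 diam(Ω)²‖v‖²` has both coefficients at most `2 max(1, diam(Ω)²)`.
    nlinarith [le_max_left 1 (Metric.diam Ω ^ 2), le_max_right 1 (Metric.diam Ω ^ 2),
      sq_nonneg ‖u‖, sq_nonneg ‖v‖]
  · have h0 : ∀ᵐ z : frontier Ω ∂(DirTrace.dirMeasure Ω θ), (fun _ => (0 : ℝ)) z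
        = DirTrace.endValue θ (Ω.indicator u) (z : EuclideanSpace ℝ (Fin d)) := by
      rw [hG0] at hG
      filter_upwards [hG, Lp.coeFn_zero ℝ 2 (DirTrace.dirMeasure Ω θ)] with z h1 h2
      rw [← h1, h2]; rfl
    have h1 := h.integral_sq_le_of_endValue_eq_zero (by
      filter_upwards [h.ae_restrict_of_ae_dirMeasure h0, ae_restrict_mem hΩ.measurableSet]
        with x hx hxΩ
      exact (hx (DirTrace.Phi_mem_frontier hΩ hb hθ hxΩ)).symm)
    rw [← DirTrace.norm_sq_eq_integral hΩ, ← DirTrace.norm_sq_eq_integral hΩ, ← mul_pow] at h1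
    exact le_of_sq_le_sq h1 (by positivity)
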